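/- Let $\mathcal S'(\mathbb R^3)$ be the space of complex tempered distributions. Let $\mathcal F^{-1}$ be the inverse Fourier transform with the normalization $\mathcal F^{-1}\phi(\xi)=(2\pi)^{-3}\int_{\mathbb R^3} e^{i x\cdot\xi}\phi(x)\,dx$ for Schwartz functions $\phi$, extended to $\mathcal S'(\mathbb R^3)$ by duality, $\langle\mathcal F^{-1}T,\phi\rangle=\langle T,\mathcal F^{-1}\phi\rangle$. For $\tau\in\mathbb R$ let $p_\tau(\xi)=|\xi|^2+2i\tau\xi_1-\tau^2$ be the symbol of the conjugated Laplacian $-\Delta+2\tau\partial_1-\tau^2$. For $z\in\mathbb C^3$ let $\mathfrak p_z(\xi)=|\xi|^2+2z\cdot\xi$, where $z\cdot w=\sum_j z_jw_j$ is the bilinear product. (1) For every $\tau\in\mathbb R$, the function $1/p_\tau$ defines a tempered distribution by integration, and $E_\tau=\mathcal F^{-1}(p_\tau^{-1})\in\mathcal S'(\mathbb R^3)$ is a fundamental solution of the conjugated Laplacian, $(-\Delta+2\tau\partial_1-\tau^2)E_\tau=\delta_0$. It is given by integration against a function that is continuous on $\mathbb R^3\setminus\{0\}$ and that, denoted again by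 $E_\tau$, satisfies $$|E_\tau(x)|\le\frac{3\sqrt2}{4\pi|x|}\qquad\text{for all } x\in\mathbb R^3\setminus\{0\}.$$ (2) There is a constant $A$ with $0<A\le 3\sqrt2/(4\pi)$ such that for every $z\in\mathbb C^3$ with $z\cdot z=0$ the following holds. The function $1/\mathfrak p_z$ defines a tempered distribution by integration, and $\mathfrak E_z=\mathcal F^{-1}(\mathfrak p_z^{-1})$ is given by integration against a function that is continuous on $\mathbb R^3\setminus\{0\}$ and that, denoted again by $\mathfrak E_z$, satisfies $$|\mathfrak E_z(x)|\le\frac{A}{|x|}\qquad\text{for all } x\in\mathbb R^3\setminus\{0\}.$$ -/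

import Mathlib

open MeasureTheory
open scoped SchwartzMap FourierTransform LineDeriv Laplacian Real

noncomputable section

/-- Euclidean space `ℝ³`. -/
abbrev E3 : Type := EuclideanSpace ℝ (Fin 3)

/-- The tempered distribution `T` is given by integration against the function `f`:
`f * φ` is Lebesgue integrable and `⟨T, φ⟩ = ∫ f φ` for every Schwartz function `φ`.
Such a `T` is uniquely determined by `f`. -/
def IsGivenBy (T : 𝓢'(E3, ℂ)) (f : E3 → ℂ) : Prop :=
  ∀ φ : 𝓢(E3, ℂ), Integrable (fun x => f x * φ x) ∧ T φ = ∫ x, f x * φ x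

/-- The inverse Fourier transform of a Schwartz function, in the normalization
`(invFourier φ)(ξ) = (2π)⁻³ ∫ exp(i x·ξ) φ(x) dx` (see `invFourier_apply`). -/
def invFourier : 𝓢(E3, ℂ) →L[ℂ] 𝓢(E3, ℂ) :=
  (((2 * π : ℝ) ^ 3)⁻¹ : ℂ) •
    (SchwartzMap.compCLMOfContinuousLinearEquiv ℂ
      (ContinuousLinearEquiv.smulLeft
        (Units.mk0 ((2 * π)⁻¹ : ℝ) (inv_ne_zero Real.two_pi_pos.ne')) : E3 ≃L[ℝ] E3) ∘L
      FourierTransform.fourierInvCLM ℂ 𝓢(E3, ℂ))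

theorem invFourier_apply (φ : 𝓢(E3, ℂ)) (ξ : E3) :
    invFourier φ ξ =
      (((2 * π : ℝ) ^ 3)⁻¹ : ℂ) * ∫ x, Complex.exp (Complex.I * (inner ℝ x ξ : ℝ)) * φ x := by
  have h : invFourier φ ξ =
      (((2 * π : ℝ) ^ 3)⁻¹ : ℂ) * (𝓕⁻ (φ : E3 → ℂ)) ((2 * π)⁻¹ • ξ) := by
    rw [← SchwartzMap.fourierInv_coe]; rfl
  rw [h, Real.fourierInv_eq']
  congr 1
  refine integral_congr_ae (Filter.Eventually.of_forall fun x => ?_)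
  have hx : 2 * π * inner ℝ x ((2 * π)⁻¹ • ξ) = inner ℝ x ξ := by
    rw [inner_smul_right, ← mul_assoc, mul_inv_cancel₀ Real.two_pi_pos.ne', one_mul]
  simp only [hx, smul_eq_mul, mul_comm Complex.I]

/-- The inverse Fourier transform of a tempered distribution, by duality:
`⟨invFourierDistr T, φ⟩ = ⟨T, invFourier φ⟩`. -/
def invFourierDistr (T : 𝓢'(E3, ℂ)) : 𝓢'(E3, ℂ) :=
  PointwiseConvergenceCLM.precomp ℂ invFourier T

/-- `E = 𝓕⁻¹(1/p)`: the function `1/p` defines a tempered distribution by integration, and `E` is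
the inverse Fourier transform of that distribution. -/
def IsInvFourierOfReciprocal (p : E3 → ℂ) (E : 𝓢'(E3, ℂ)) : Prop :=
  ∃ M : 𝓢'(E3, ℂ), IsGivenBy M (fun ξ => (p ξ)⁻¹) ∧ E = invFourierDistr M

/-- The symbol `p_τ(ξ) = |ξ|² + 2iτξ₁ - τ²`. -/
def conjSymbol (τ : ℝ) (ξ : E3) : ℂ :=
  (‖ξ‖ ^ 2 : ℝ) + 2 * Complex.I * τ * (ξ 0 : ℝ) - (τ : ℂ) ^ 2

/-- The conjugated (negative) Laplacian `-Δ + 2τ∂₁ - τ²` on tempered distributions. -/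
def conjLaplacian (τ : ℝ) (u : 𝓢'(E3, ℂ)) : 𝓢'(E3, ℂ) :=
  -(Δ u) + (2 * τ : ℂ) • ∂_{(EuclideanSpace.single 0 1 : E3)} u - ((τ : ℂ) ^ 2) • u

/-- The symbol `𝔭_z(ξ) = |ξ|² + 2 z·ξ`, with the bilinear (not sesquilinear) product. -/
def cgoSymbol (z : Fin 3 → ℂ) (ξ : E3) : ℂ :=
  (‖ξ‖ ^ 2 : ℝ) + 2 * ∑ j, z j * (ξ j : ℝ)

end

/-!
Choose the first coordinate axis as distinguished and write `t` for the coordinate along it and `r`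
for the distance to it. For `τ ≥ 0` the inverse Fourier transform of `1 / p_τ` is the function

  `e^{τt} / (4π) * (1 / √(t² + r²) - ∫₀^τ J₀(rρ) e^{-tρ} dρ)`          (`conjKernel`).

To see this, invert the Fourier transform first along the axis and then across it. For a frequency
`ω` across the axis with `ρ = |ω| ≠ τ`, the function `s ↦ 1 / p_τ(s, ω)` is the Fourier transform of
an explicit combination of exponentials, bounded by `1 / (2ρ)` (`axisKernel_transform`,
`abs_axisKernel_le`). This bound makes the resulting integral over `(t, ω)`, tested against a
rapidly decaying function, absolutely convergent. For fixed `t ≠ 0` the remaining transform in `ω`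
is that of an integrable radial function, hence a Hankel transform (`integral_radial_mul_cexp`),
evaluated by Lipschitz's integral for `J₀` (`integral_exp_mul_besselJ0`). The outcome is
`IsFourierPair.integral_inv_conjSymbol_mul`.

For the bound, `|J₀| ≤ 1` and `|∫ J₀| ≤ 3` over every subinterval of `[0, ∞)`. With a second mean
value estimate, the kernel is bounded up to the factor `4π` by `min (1/t) (3/r)` if `t > 0`, and by
`1/√(t² + r²) + min (1/|t|) (3/r)` if `t ≤ 0`; both are at most `3√2 / √(t² + r²)`
(`abs_conjKernel_le`). The formula is visibly continuous off the origin.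

For `τ > 0` the symbol vanishes on the circle `s = 0`, `ρ = τ`. Since `1 / |p_τ|` is dominated by
`|s|^{-1/2} |ρ - τ|^{-1/2} / ρ`, it is locally integrable all the same (`le_norm_conjSymbol`,
`integrable_inv_conjSymbol_mul`). That the kernel is a fundamental solution is then the identity
`p_τ * (1 / p_τ) = 1` almost everywhere, on the Fourier side (`conjLaplacian_eq_delta`).

All the other symbols are `ξ ↦ p_τ(R(ξ + a))` with `τ ≥ 0` and a reflection `R`: for `p_{-τ}` reflect
the axis, and for `z = a + ib` with `z · z = 0`, that is `|a| = |b|` and `a · b = 0`, take `τ = |b|`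
and let `R` send `b` to the axis. This composes the kernel with `R` and multiplies it by a character
of modulus one (`exists_invFourier_reciprocal`), so the same constant serves for both parts.
-/

/-! ### The Bessel function `J₀` -/

/-- The Bessel function `J₀`, through the integral `J₀(s) = (2/π) ∫₀^{π/2} cos (s sin θ) dθ`. -/
noncomputable def besselJ0 (s : ℝ) : ℝ :=
  2 / π * ∫ θ in (0 : ℝ)..π / 2, Real.cos (s * Real.sin θ)

theorem continuous_besselJ0 : Continuous besselJ0 := by
  unfold besselJ0
  refine continuous_const.mul ?_
  exact intervalIntegral.continuous_parametric_intervalIntegral_of_continuous'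
    (f := fun s θ => Real.cos (s * Real.sin θ)) (by fun_prop) 0 (π / 2)

theorem abs_besselJ0_le_one (s : ℝ) : |besselJ0 s| ≤ 1 := by
  have h : ‖∫ θ in (0 : ℝ)..π / 2, Real.cos (s * Real.sin θ)‖ ≤ 1 * |π / 2 - 0| :=
    intervalIntegral.norm_integral_le_of_norm_le_const fun θ _ => Real.abs_cos_le_one _
  rw [Real.norm_eq_abs, sub_zero, abs_of_pos (by positivity : 0 < π / 2), one_mul] at h
  rw [besselJ0, abs_mul, abs_of_pos (by positivity : 0 < 2 / π)]
  calc 2 / π * |∫ θ in (0 : ℝ)..π / 2, Real.cos (s * Real.sin θ)| ≤ 2 / π * (π / 2) := by gcongr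
    _ = 1 := by field_simp

theorem integral_comp_cos_eq {F : ℝ → ℂ} (hF : Continuous F) :
    ∫ θ in -π..π, F (Real.cos θ) =
      2 * ∫ θ in (0 : ℝ)..π / 2, (F (Real.sin θ) + F (-Real.sin θ)) := by
  have hi : ∀ a b : ℝ, IntervalIntegrable (fun θ => F (Real.cos θ)) volume a b :=
    fun a b => (hF.comp Real.continuous_cos).intervalIntegrable a b
  have h1 : ∫ θ in -π..0, F (Real.cos θ) = ∫ θ in (0 : ℝ)..π, F (Real.cos θ) := by
    have := intervalIntegral.integral_comp_neg (a := 0) (b := π) (fun θ => F (Real.cos θ))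
    simp only [Real.cos_neg, neg_zero] at this
    exact this.symm
  have h2 : ∫ θ in (π / 2)..π, F (Real.cos θ) = ∫ θ in (0 : ℝ)..π / 2, F (-Real.sin θ) := by
    have := intervalIntegral.integral_comp_add_right (a := 0) (b := π / 2)
      (fun θ => F (Real.cos θ)) (π / 2)
    simp only [Real.cos_add_pi_div_two, zero_add, add_halves] at this
    exact this.symm
  have h3 : ∫ θ in (0 : ℝ)..π / 2, F (Real.cos θ) = ∫ θ in (0 : ℝ)..π / 2, F (Real.sin θ) := by
    have := intervalIntegral.integral_comp_sub_left (a := 0) (b := π / 2)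
      (fun θ => F (Real.cos θ)) (π / 2)
    simp only [Real.cos_pi_div_two_sub, sub_self, sub_zero] at this
    exact this.symm
  rw [← intervalIntegral.integral_add_adjacent_intervals (hi (-π) 0) (hi 0 π), h1,
    ← intervalIntegral.integral_add_adjacent_intervals (hi 0 (π / 2)) (hi (π / 2) π), h2, h3,
    intervalIntegral.integral_add]
  · ring
  · exact (hF.comp Real.continuous_sin).intervalIntegrable _ _
  · exact (hF.comp Real.continuous_sin.neg).intervalIntegrable _ _

theorem integral_cexp_mul_cos (s : ℝ) :
    ∫ θ in -π..π, Complex.exp (Complex.I * (s * Real.cos θ : ℝ)) = 2 * π * besselJ0 s := by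
  rw [integral_comp_cos_eq (F := fun u => Complex.exp (Complex.I * (s * u : ℝ))) (by fun_prop)]
  have : ∀ θ : ℝ, Complex.exp (Complex.I * (s * Real.sin θ : ℝ)) +
      Complex.exp (Complex.I * (s * -Real.sin θ : ℝ)) =
        ((2 * Real.cos (s * Real.sin θ) : ℝ) : ℂ) := by
    intro θ
    push_cast
    rw [Complex.two_cos]
    congr 2 <;> ring
  simp only [this]
  rw [intervalIntegral.integral_ofReal, intervalIntegral.integral_const_mul, besselJ0]
  push_cast
  have : (π : ℂ) ≠ 0 := by exact_mod_cast Real.pi_ne_zero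
  field_simp

theorem abs_integral_sin_div_le_two {a b : ℝ} (ha : 1 ≤ a) (hab : a ≤ b) :
    |∫ s in a..b, Real.sin s / s| ≤ 2 := by
  have hpos : ∀ s ∈ Set.uIcc a b, 0 < s := fun s hs => by
    rw [Set.uIcc_of_le hab] at hs; linarith [hs.1]
  have hd : ∀ s ∈ Set.uIcc a b,
      HasDerivAt (fun s => -Real.cos s / s) (Real.sin s / s + Real.cos s / s ^ 2) s := by
    intro s hs
    have hs0 := (hpos s hs).ne'
    refine ((Real.hasDerivAt_cos s).fun_neg.fun_div (hasDerivAt_id' s) hs0).congr_deriv ?_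
    field_simp
    ring
  have hd' : ∀ s ∈ Set.uIcc a b, HasDerivAt (fun s : ℝ => -s⁻¹) ((s ^ 2)⁻¹) s := by
    intro s hs
    simpa using (hasDerivAt_inv (hpos s hs).ne').fun_neg
  have c1 : ContinuousOn (fun s : ℝ => Real.sin s / s) (Set.uIcc a b) :=
    Real.continuous_sin.continuousOn.div continuousOn_id fun s hs => (hpos s hs).ne'
  have c2 : ContinuousOn (fun s : ℝ => Real.cos s / s ^ 2) (Set.uIcc a b) :=
    Real.continuous_cos.continuousOn.div (continuousOn_id.pow 2)
      fun s hs => (pow_pos (hpos s hs) 2).ne'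
  have c3 : ContinuousOn (fun s : ℝ => (s ^ 2)⁻¹) (Set.uIcc a b) :=
    (continuousOn_id.pow 2).inv₀ fun s hs => (pow_pos (hpos s hs) 2).ne'
  have e1 := intervalIntegral.integral_eq_sub_of_hasDerivAt hd (c1.add c2).intervalIntegrable
  have e2 := intervalIntegral.integral_eq_sub_of_hasDerivAt hd' c3.intervalIntegrable
  rw [intervalIntegral.integral_add c1.intervalIntegrable c2.intervalIntegrable] at e1
  have e3 : ‖∫ s in a..b, Real.cos s / s ^ 2‖ ≤ ∫ s in a..b, (s ^ 2)⁻¹ := by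
    refine intervalIntegral.norm_integral_le_of_norm_le hab ?_ c3.intervalIntegrable
    refine Filter.Eventually.of_forall fun s hs => ?_
    rw [norm_div, Real.norm_eq_abs, div_eq_mul_inv, Real.norm_of_nonneg (by positivity)]
    exact mul_le_of_le_one_left (by positivity) (Real.abs_cos_le_one s)
  rw [e2, Real.norm_eq_abs] at e3
  have hb : 0 < b := by linarith
  have ha' : 0 < a := by linarith
  have f1 : |(-Real.cos b / b)| ≤ b⁻¹ := by
    rw [abs_div, abs_neg, abs_of_pos hb, div_eq_mul_inv]
    exact mul_le_of_le_one_left (by positivity) (Real.abs_cos_le_one b)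
  have f2 : |(-Real.cos a / a)| ≤ a⁻¹ := by
    rw [abs_div, abs_neg, abs_of_pos ha', div_eq_mul_inv]
    exact mul_le_of_le_one_left (by positivity) (Real.abs_cos_le_one a)
  have f3 : a⁻¹ ≤ 1 := inv_le_one_of_one_le₀ ha
  rw [abs_le] at *
  constructor <;> linarith [f1.1, f1.2, f2.1, f2.2, e3.1, e3.2]

theorem abs_integral_sinc_le_three {a b : ℝ} (ha : 0 ≤ a) (hab : a ≤ b) :
    |∫ s in a..b, Real.sinc s| ≤ 3 := by
  have small : ∀ c d : ℝ, |d - c| ≤ 1 → |∫ s in c..d, Real.sinc s| ≤ 1 := by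
    intro c d h
    have := intervalIntegral.norm_integral_le_of_norm_le_const (a := c) (b := d) (C := 1)
      (f := Real.sinc) fun s _ => Real.abs_sinc_le_one s
    rw [Real.norm_eq_abs] at this
    linarith
  have large : ∀ c : ℝ, 1 ≤ c → c ≤ b → |∫ s in c..b, Real.sinc s| ≤ 2 := by
    intro c hc hcb
    rw [intervalIntegral.integral_congr (g := fun s => Real.sin s / s)]
    · exact abs_integral_sin_div_le_two hc hcb
    · intro s hs
      rw [Set.uIcc_of_le hcb] at hs
      exact Real.sinc_of_ne_zero (by linarith [hs.1])
  rcases le_total 1 a with h1 | h1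
  · linarith [large a h1 hab]
  rcases le_total b 1 with h2 | h2
  · have : |b - a| ≤ 1 := by rw [abs_le]; constructor <;> linarith
    linarith [small a b this]
  rw [← intervalIntegral.integral_add_adjacent_intervals
    (Real.continuous_sinc.intervalIntegrable a 1) (Real.continuous_sinc.intervalIntegrable 1 b)]
  have : |1 - a| ≤ 1 := by rw [abs_le]; constructor <;> linarith
  linarith [small a 1 this, large 1 le_rfl h2,
    abs_add_le (∫ s in a..1, Real.sinc s) (∫ s in (1 : ℝ)..b, Real.sinc s)]

theorem integral_cos_mul_sin_mul_cos (s : ℝ) :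
    ∫ θ in (0 : ℝ)..π / 2, Real.cos (s * Real.sin θ) * Real.cos θ = Real.sinc s := by
  rcases eq_or_ne s 0 with rfl | hs
  · simp
  have hd : ∀ θ ∈ Set.uIcc (0 : ℝ) (π / 2), HasDerivAt (fun θ => Real.sin (s * Real.sin θ) / s)
      (Real.cos (s * Real.sin θ) * Real.cos θ) θ := by
    intro θ _
    refine (((Real.hasDerivAt_sin θ).const_mul s).sin.div_const s).congr_deriv ?_
    field_simp
  rw [intervalIntegral.integral_eq_sub_of_hasDerivAt hd
    (Continuous.intervalIntegrable (by fun_prop) _ _), Real.sinc_of_ne_zero hs]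
  simp

theorem integral_sin_div_one_add_cos :
    ∫ θ in (0 : ℝ)..π / 2, Real.sin θ / (1 + Real.cos θ) = Real.log 2 := by
  have hpos : ∀ θ ∈ Set.uIcc (0 : ℝ) (π / 2), 0 < 1 + Real.cos θ := by
    intro θ hθ
    rw [Set.uIcc_of_le (by positivity)] at hθ
    have := Real.cos_nonneg_of_neg_pi_div_two_le_of_le (x := θ)
      (by linarith [hθ.1, Real.pi_pos]) hθ.2
    linarith
  have hd : ∀ θ ∈ Set.uIcc (0 : ℝ) (π / 2), HasDerivAt (fun θ => -Real.log (1 + Real.cos θ))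
      (Real.sin θ / (1 + Real.cos θ)) θ := by
    intro θ hθ
    refine (((Real.hasDerivAt_cos θ).const_add 1).log (hpos θ hθ).ne').fun_neg.congr_deriv ?_
    ring
  rw [intervalIntegral.integral_eq_sub_of_hasDerivAt hd]
  · simp; norm_num
  · refine ContinuousOn.intervalIntegrable ?_
    exact Real.continuous_sin.continuousOn.div (by fun_prop) fun θ hθ => (hpos θ hθ).ne'

/-- The integrals of `J₀` over subintervals of `[0, ∞)` are bounded. Splitting
`1 = cos θ + (1 - cos θ)` in the definition of `J₀` gives the cardinal sine, whose integrals are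
bounded, and a remainder in which `1 - cos θ` cancels the singularity `1 / sin θ` that
integration in `s` creates. -/
theorem abs_integral_besselJ0_le_three {a b : ℝ} (ha : 0 ≤ a) (hab : a ≤ b) :
    |∫ s in a..b, besselJ0 s| ≤ 3 := by
  have hJ : ∀ s, besselJ0 s = 2 / π * Real.sinc s + 2 / π *
      ∫ θ in (0 : ℝ)..π / 2, Real.cos (s * Real.sin θ) * (1 - Real.cos θ) := by
    intro s
    rw [← integral_cos_mul_sin_mul_cos, ← mul_add, ← intervalIntegral.integral_add, besselJ0]
    · congr 2; ext θ; ring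
    · exact Continuous.intervalIntegrable (by fun_prop) _ _
    · exact Continuous.intervalIntegrable (by fun_prop) _ _
  have hR : Continuous fun s : ℝ =>
      ∫ θ in (0 : ℝ)..π / 2, Real.cos (s * Real.sin θ) * (1 - Real.cos θ) :=
    intervalIntegral.continuous_parametric_intervalIntegral_of_continuous'
      (f := fun s θ => Real.cos (s * Real.sin θ) * (1 - Real.cos θ)) (by fun_prop) 0 (π / 2)
  have hswap : ∫ s in a..b, ∫ θ in (0 : ℝ)..π / 2, Real.cos (s * Real.sin θ) * (1 - Real.cos θ) =
      ∫ θ in (0 : ℝ)..π / 2, ∫ s in a..b, Real.cos (s * Real.sin θ) * (1 - Real.cos θ) := by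
    refine intervalIntegral_intervalIntegral_swap ?_
    have hc : Continuous (Function.uncurry fun s θ : ℝ =>
        Real.cos (s * Real.sin θ) * (1 - Real.cos θ)) := by fun_prop
    exact (hc.continuousOn.integrableOn_compact
      (isCompact_uIcc.prod isCompact_uIcc)).mono_set
      (Set.prod_mono Set.uIoc_subset_uIcc Set.uIoc_subset_uIcc)
  have hrem : |∫ θ in (0 : ℝ)..π / 2, ∫ s in a..b,
      Real.cos (s * Real.sin θ) * (1 - Real.cos θ)| ≤ 2 * Real.log 2 := by
    rw [← integral_sin_div_one_add_cos, ← intervalIntegral.integral_const_mul, ← Real.norm_eq_abs]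
    refine intervalIntegral.norm_integral_le_of_norm_le (by positivity) ?_ ?_
    · refine Filter.Eventually.of_forall fun θ hθ => ?_
      have hs : 0 < Real.sin θ := Real.sin_pos_of_pos_of_lt_pi hθ.1 (by linarith [hθ.2, Real.pi_pos])
      have hc : 0 ≤ Real.cos θ := Real.cos_nonneg_of_neg_pi_div_two_le_of_le
        (by linarith [hθ.1, Real.pi_pos]) hθ.2
      have hi : ∫ s in a..b, Real.cos (s * Real.sin θ) =
          (Real.sin (b * Real.sin θ) - Real.sin (a * Real.sin θ)) / Real.sin θ := by
        rw [intervalIntegral.integral_comp_mul_right (fun x => Real.cos x) hs.ne', integral_cos,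
          smul_eq_mul]
        ring
      have h2 : |Real.sin (b * Real.sin θ) - Real.sin (a * Real.sin θ)| ≤ 2 := by
        refine (abs_sub _ _).trans ?_
        linarith [Real.abs_sin_le_one (b * Real.sin θ), Real.abs_sin_le_one (a * Real.sin θ)]
      have h3 : (1 - Real.cos θ) / Real.sin θ = Real.sin θ / (1 + Real.cos θ) := by
        rw [div_eq_div_iff hs.ne' (by linarith)]
        nlinarith [Real.sin_sq_add_cos_sq θ]
      rw [intervalIntegral.integral_mul_const, hi, div_mul_eq_mul_div, mul_div_assoc, h3, norm_mul,
        Real.norm_eq_abs, Real.norm_of_nonneg (by positivity)]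
      gcongr
    · refine IntervalIntegrable.const_mul ?_ 2
      refine ContinuousOn.intervalIntegrable ?_
      refine Real.continuous_sin.continuousOn.div (by fun_prop) fun θ hθ => ?_
      rw [Set.uIcc_of_le (by positivity)] at hθ
      have hc : 0 ≤ Real.cos θ := Real.cos_nonneg_of_neg_pi_div_two_le_of_le
        (by linarith [hθ.1, Real.pi_pos]) hθ.2
      linarith
  simp only [hJ]
  rw [intervalIntegral.integral_add, intervalIntegral.integral_const_mul,
    intervalIntegral.integral_const_mul, hswap, ← mul_add, abs_mul,
    abs_of_pos (by positivity : 0 < 2 / π)]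
  · have h1 := abs_integral_sinc_le_three ha hab
    have h2 := abs_add_le (∫ s in a..b, Real.sinc s) (∫ θ in (0 : ℝ)..π / 2, ∫ s in a..b,
      Real.cos (s * Real.sin θ) * (1 - Real.cos θ))
    have h3 := Real.log_two_lt_d9
    rw [div_mul_eq_mul_div, div_le_iff₀ Real.pi_pos]
    linarith [Real.pi_gt_three]
  · exact (continuous_const.mul Real.continuous_sinc).intervalIntegrable _ _
  · exact (continuous_const.mul hR).intervalIntegrable _ _

/-- A second mean value estimate: the weight `e^{-k(x-a)}` is decreasing and equals `1` at `a`. -/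
theorem abs_integral_mul_exp_le {f : ℝ → ℝ} (hf : Continuous f) {a b k C : ℝ} (hab : a ≤ b)
    (hk : 0 ≤ k) (hC : ∀ x ∈ Set.Icc a b, |∫ y in a..x, f y| ≤ C) :
    |∫ x in a..b, f x * Real.exp (-(k * (x - a)))| ≤ C := by
  set G : ℝ → ℝ := fun x => ∫ y in a..x, f y with hG
  have hGd : ∀ x, HasDerivAt G (f x) x := fun x => hf.integral_hasStrictDerivAt a x |>.hasDerivAt
  have hGc : Continuous G := continuous_iff_continuousAt.2 fun x => (hGd x).continuousAt
  have hw : ∀ x, HasDerivAt (fun x => Real.exp (-(k * (x - a))))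
      (-(k * Real.exp (-(k * (x - a))))) x := by
    intro x
    refine ((((hasDerivAt_id' x).sub_const a).const_mul k).fun_neg.exp).congr_deriv ?_
    ring
  have hparts := intervalIntegral.integral_deriv_mul_eq_sub (a := a) (b := b)
    (u := G) (v := fun x => Real.exp (-(k * (x - a)))) (u' := f)
    (v' := fun x => -(k * Real.exp (-(k * (x - a))))) (fun x _ => hGd x) (fun x _ => hw x)
    (hf.intervalIntegrable _ _) (Continuous.intervalIntegrable (by fun_prop) _ _)
  rw [intervalIntegral.integral_add (Continuous.intervalIntegrable (by fun_prop) _ _)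
    (Continuous.intervalIntegrable (by fun_prop) _ _)] at hparts
  have hGa : G a = 0 := intervalIntegral.integral_same
  have hwi : ∫ x in a..b, k * Real.exp (-(k * (x - a))) = 1 - Real.exp (-(k * (b - a))) := by
    rw [intervalIntegral.integral_eq_sub_of_hasDerivAt
      (f := fun x => -Real.exp (-(k * (x - a)))) (fun x _ => ?_)
      (Continuous.intervalIntegrable (by fun_prop) _ _)]
    · simp; ring
    · exact (hw x).fun_neg.congr_deriv (neg_neg _)
  have hrest : |∫ x in a..b, G x * -(k * Real.exp (-(k * (x - a))))| ≤
      C * (1 - Real.exp (-(k * (b - a)))) := by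
    rw [← hwi, ← intervalIntegral.integral_const_mul, ← Real.norm_eq_abs]
    refine intervalIntegral.norm_integral_le_of_norm_le hab
      (Filter.Eventually.of_forall fun x hx => ?_)
      (Continuous.intervalIntegrable (by fun_prop) _ _)
    rw [norm_mul, norm_neg, Real.norm_of_nonneg (by positivity : 0 ≤ k * Real.exp _)]
    exact mul_le_mul_of_nonneg_right (hC x ⟨hx.1.le, hx.2⟩) (by positivity)
  have hlast : |G b * Real.exp (-(k * (b - a)))| ≤ C * Real.exp (-(k * (b - a))) := by
    rw [abs_mul, abs_of_pos (Real.exp_pos _)]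
    exact mul_le_mul_of_nonneg_right (hC b ⟨hab, le_rfl⟩) (Real.exp_pos _).le
  rw [hGa, zero_mul, sub_zero] at hparts
  rw [abs_le] at *
  constructor <;> linarith [hrest.1, hrest.2, hlast.1, hlast.2]

theorem integral_exp_mul_cos_Ioi {a : ℝ} (ha : 0 < a) (b : ℝ) :
    ∫ x in Set.Ioi (0 : ℝ), Real.exp (-(a * x)) * Real.cos (b * x) = a / (a ^ 2 + b ^ 2) := by
  have hre : (-a + b * Complex.I : ℂ).re < 0 := by simpa using ha
  have h := integral_exp_mul_complex_Ioi hre 0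
  have hi := integrableOn_exp_mul_complex_Ioi hre 0
  have h2 := congrArg Complex.re h
  rw [← RCLike.re_eq_complex_re, ← integral_re hi] at h2
  have e : ∀ x : ℝ, RCLike.re (Complex.exp ((-a + b * Complex.I : ℂ) * x)) =
      Real.exp (-(a * x)) * Real.cos (b * x) := by
    intro x
    rw [RCLike.re_eq_complex_re, Complex.exp_re]
    simp
  simp only [e] at h2
  rw [h2]
  simp only [RCLike.re_eq_complex_re, Complex.ofReal_zero, mul_zero, Complex.exp_zero]
  rw [neg_div, Complex.neg_re, Complex.div_re]
  simp [Complex.normSq_apply]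
  field_simp

theorem integral_div_sq_add_sq_mul_sin_sq {a : ℝ} (ha : 0 < a) (r : ℝ) :
    ∫ θ in (0 : ℝ)..π / 2, a / (a ^ 2 + r ^ 2 * Real.sin θ ^ 2) =
      π / 2 / √(a ^ 2 + r ^ 2) := by
  set b := √(a ^ 2 + r ^ 2) with hb
  have hb0 : 0 < b := Real.sqrt_pos.2 (by positivity)
  have hb2 : b ^ 2 = a ^ 2 + r ^ 2 := Real.sq_sqrt (by positivity)
  have hden : ∀ θ : ℝ, 0 < a * Real.cos θ ^ 2 + b * Real.sin θ ^ 2 := by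
    intro θ
    rcases eq_or_ne (Real.cos θ) 0 with h | h
    · have := Real.sin_sq_add_cos_sq θ
      rw [h] at this ⊢
      nlinarith
    · positivity
  -- A primitive of `a b / (a² cos² θ + b² sin² θ)` without the jump of `arctan ((b / a) tan θ)`.
  have hd : ∀ θ ∈ Set.uIcc (0 : ℝ) (π / 2), HasDerivAt
      (fun θ => (θ + Real.arctan ((b - a) * (Real.sin θ * Real.cos θ) /
        (a * Real.cos θ ^ 2 + b * Real.sin θ ^ 2))) / b)
      (a / (a ^ 2 + r ^ 2 * Real.sin θ ^ 2)) θ := by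
    intro θ _
    have h1 := ((Real.hasDerivAt_sin θ).fun_mul (Real.hasDerivAt_cos θ)).const_mul (b - a)
    have h2 := (((Real.hasDerivAt_cos θ).fun_pow 2).const_mul a).fun_add
      (((Real.hasDerivAt_sin θ).fun_pow 2).const_mul b)
    refine (((hasDerivAt_id' θ).fun_add (h1.fun_div h2 (hden θ).ne').arctan).div_const
      b).congr_deriv ?_
    have hD := hden θ
    have hsc := Real.sin_sq_add_cos_sq θ
    set s := Real.sin θ
    set c := Real.cos θ
    have hr : r ^ 2 = b ^ 2 - a ^ 2 := by linarith
    have hE : 0 < a ^ 2 + r ^ 2 * s ^ 2 := by positivity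
    have hE' : a ^ 2 + r ^ 2 * s ^ 2 = a ^ 2 * c ^ 2 + b ^ 2 * s ^ 2 := by
      rw [hr]; linear_combination (-a ^ 2) * hsc
    have hF : (a * c ^ 2 + b * s ^ 2) ^ 2 + ((b - a) * (s * c)) ^ 2 =
        a ^ 2 * c ^ 2 + b ^ 2 * s ^ 2 := by
      linear_combination (a ^ 2 * c ^ 2 + b ^ 2 * s ^ 2) * hsc
    have hF0 : 0 < a ^ 2 * c ^ 2 + b ^ 2 * s ^ 2 := hE' ▸ hE
    rw [hE']
    have hG : 1 + ((b - a) * (s * c) / (a * c ^ 2 + b * s ^ 2)) ^ 2 =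
        (a ^ 2 * c ^ 2 + b ^ 2 * s ^ 2) / (a * c ^ 2 + b * s ^ 2) ^ 2 := by
      rw [← hF]; field_simp
    rw [hG]
    field_simp
    push_cast
    linear_combination (a * b * (s ^ 2 + c ^ 2 + 1) - a ^ 2 * c ^ 2 - b ^ 2 * s ^ 2) * hsc
  rw [intervalIntegral.integral_eq_sub_of_hasDerivAt hd]
  · simp
  · refine Continuous.intervalIntegrable ?_ _ _
    exact continuous_const.div (by fun_prop) fun θ => by positivity

/-- Lipschitz's integral `∫₀^∞ e^{-aρ} J₀(rρ) dρ = 1 / √(a² + r²)`. -/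
theorem integral_exp_mul_besselJ0 {a : ℝ} (ha : 0 < a) (r : ℝ) :
    ∫ ρ in Set.Ioi (0 : ℝ), Real.exp (-(a * ρ)) * besselJ0 (r * ρ) = (√(a ^ 2 + r ^ 2))⁻¹ := by
  have e : ∀ ρ : ℝ, Real.exp (-(a * ρ)) * besselJ0 (r * ρ) = 2 / π *
      ∫ θ in (0 : ℝ)..π / 2, Real.exp (-(a * ρ)) * Real.cos (r * Real.sin θ * ρ) := by
    intro ρ
    rw [besselJ0, intervalIntegral.integral_const_mul]
    simp only [mul_right_comm r]
    ring
  simp only [e]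
  rw [integral_const_mul, ← intervalIntegral_integral_swap]
  · simp only [integral_exp_mul_cos_Ioi ha, mul_pow]
    rw [integral_div_sq_add_sq_mul_sin_sq ha]
    field_simp
  · have h1 : Integrable (fun ρ : ℝ => Real.exp (-(a * ρ))) (volume.restrict (Set.Ioi 0)) := by
      have := integrableOn_exp_mul_Ioi (neg_lt_zero.2 ha) 0
      simp only [neg_mul] at this
      exact this
    have h2 : Integrable (fun _ : ℝ => (1 : ℝ)) (volume.restrict (Set.uIoc 0 (π / 2))) :=
      continuous_const.integrableOn_uIoc
    refine (h2.mul_prod h1).mono (Continuous.aestronglyMeasurable (by fun_prop)) ?_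
    refine Filter.Eventually.of_forall fun z => ?_
    simp only [Function.uncurry, norm_mul, one_mul]
    exact mul_le_of_le_one_right (norm_nonneg _) (Real.abs_cos_le_one _)

/-! ### The kernel -/

theorem abs_integral_mul_exp_le_inv {f : ℝ → ℝ} (hf : ∀ x, |f x| ≤ 1) {a b k : ℝ} (hab : a ≤ b)
    (hk : 0 < k) : |∫ x in a..b, f x * Real.exp (-(k * (x - a)))| ≤ 1 / k := by
  have hd : ∀ x ∈ Set.uIcc a b, HasDerivAt (fun x => -Real.exp (-(k * (x - a))) / k)
      (Real.exp (-(k * (x - a)))) x := by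
    intro x _
    refine ((((hasDerivAt_id' x).sub_const a).const_mul k).fun_neg.exp.fun_neg.div_const
      k).congr_deriv ?_
    field_simp
  have hi : IntervalIntegrable (fun x => Real.exp (-(k * (x - a)))) volume a b :=
    Continuous.intervalIntegrable (by fun_prop) _ _
  have h := intervalIntegral.norm_integral_le_of_norm_le hab
    (f := fun x => f x * Real.exp (-(k * (x - a)))) (Filter.Eventually.of_forall fun x _ => by
      rw [norm_mul, Real.norm_of_nonneg (Real.exp_pos _).le]
      exact mul_le_of_le_one_left (Real.exp_pos _).le (hf x)) hi
  rw [intervalIntegral.integral_eq_sub_of_hasDerivAt hd hi, Real.norm_eq_abs] at h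
  refine h.trans ?_
  simp only [sub_self, mul_zero, neg_zero, Real.exp_zero, neg_div, sub_neg_eq_add]
  have : 0 < Real.exp (-(k * (b - a))) / k := by positivity
  linarith

theorem abs_integral_besselJ0_mul_le {r a b : ℝ} (hr : 0 < r) (ha : 0 ≤ a) (hab : a ≤ b) :
    |∫ ρ in a..b, besselJ0 (r * ρ)| ≤ 3 / r := by
  rw [intervalIntegral.integral_comp_mul_left besselJ0 hr.ne', smul_eq_mul, abs_mul,
    abs_of_pos (inv_pos.2 hr), div_eq_inv_mul]
  gcongr
  exact abs_integral_besselJ0_le_three (by positivity) (by gcongr)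

/-- The fundamental solution of the conjugated Laplacian for `τ ≥ 0`, as a function of the
coordinate `t` along the distinguished axis and of the distance `r` to this axis. -/
noncomputable def conjKernel (τ t r : ℝ) : ℝ :=
  Real.exp (τ * t) / (4 * π) *
    ((√(t ^ 2 + r ^ 2))⁻¹ - ∫ ρ in (0 : ℝ)..τ, besselJ0 (r * ρ) * Real.exp (-(t * ρ)))

theorem integrableOn_exp_mul_besselJ0 {a : ℝ} (ha : 0 < a) (r c : ℝ) :
    IntegrableOn (fun ρ : ℝ => Real.exp (-(a * ρ)) * besselJ0 (r * ρ)) (Set.Ioi c) := by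
  have h := integrableOn_exp_mul_Ioi (neg_lt_zero.2 ha) c
  simp only [neg_mul] at h
  have hc : Continuous fun ρ : ℝ => Real.exp (-(a * ρ)) * besselJ0 (r * ρ) :=
    (by fun_prop : Continuous fun ρ : ℝ => Real.exp (-(a * ρ))).mul
      (continuous_besselJ0.comp (continuous_const_mul r))
  refine Integrable.mono h hc.aestronglyMeasurable (Filter.Eventually.of_forall fun ρ => ?_)
  rw [norm_mul]
  exact mul_le_of_le_one_right (norm_nonneg _) (abs_besselJ0_le_one _)

/-- For `t > 0` the kernel is an integral over `(τ, ∞)`, without exponential growth. -/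
theorem tendsto_integral_conjKernel {t : ℝ} (ht : 0 < t) (τ r : ℝ) :
    Filter.Tendsto (fun T => ∫ ρ in τ..T, besselJ0 (r * ρ) * Real.exp (-(t * (ρ - τ))))
      Filter.atTop (nhds (4 * π * conjKernel τ t r)) := by
  have hi := integrableOn_exp_mul_besselJ0 ht r 0
  have h := intervalIntegral_tendsto_integral_Ioi 0 hi Filter.tendsto_id
  rw [integral_exp_mul_besselJ0 ht] at h
  have hii : ∀ a b : ℝ, IntervalIntegrable (fun ρ : ℝ => Real.exp (-(t * ρ)) * besselJ0 (r * ρ))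
      volume a b := fun a b => Continuous.intervalIntegrable
    ((by fun_prop : Continuous fun ρ : ℝ => Real.exp (-(t * ρ))).mul
      (continuous_besselJ0.comp (continuous_const_mul r))) a b
  have h2 := (h.sub_const (∫ ρ in (0 : ℝ)..τ, Real.exp (-(t * ρ)) * besselJ0 (r * ρ))).const_mul
    (Real.exp (τ * t))
  convert h2 using 1
  · ext T
    rw [id, intervalIntegral.integral_interval_sub_left (hii _ _) (hii _ _),
      ← intervalIntegral.integral_const_mul]
    congr 1
    ext ρ
    rw [← mul_assoc, ← Real.exp_add, mul_comm]
    congr 2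
    ring
  · rw [conjKernel]
    simp only [mul_comm (besselJ0 _)]
    field_simp

theorem conjKernel_eq_sub_integral (τ t r : ℝ) :
    4 * π * conjKernel τ t r = Real.exp (τ * t) * (√(t ^ 2 + r ^ 2))⁻¹ -
      ∫ u in (0 : ℝ)..τ, besselJ0 (r * (τ - u)) * Real.exp (-(-t * (u - 0))) := by
  have h := intervalIntegral.integral_comp_sub_left (a := 0) (b := τ)
    (fun ρ => Real.exp (τ * t) * (besselJ0 (r * ρ) * Real.exp (-(t * ρ)))) τ
  simp only [sub_self, sub_zero] at h
  have e : ∀ u : ℝ, besselJ0 (r * (τ - u)) * Real.exp (-(-t * (u - 0))) =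
      Real.exp (τ * t) * (besselJ0 (r * (τ - u)) * Real.exp (-(t * (τ - u)))) := by
    intro u
    rw [mul_left_comm, ← Real.exp_add]
    congr 2
    ring
  simp only [e]
  rw [h, intervalIntegral.integral_const_mul, conjKernel]
  field_simp

/-- Up to the factor `4π`, both `1/|t|` and `3/r` bound the whole kernel for `t > 0`, and its second
term for `t ≤ 0`. The thresholds `r ≤ t` and `N/3 ≤ |t|`, with `N = √(t² + r²)`, that decide between
the two bounds are what the constant `3√2` allows. -/
theorem abs_conjKernel_le {τ t r : ℝ} (hτ : 0 ≤ τ) (hr : 0 ≤ r) (h0 : 0 < t ^ 2 + r ^ 2) :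
    |conjKernel τ t r| ≤ 3 * √2 / (4 * π * √(t ^ 2 + r ^ 2)) := by
  set N := √(t ^ 2 + r ^ 2) with hN
  have hN0 : 0 < N := Real.sqrt_pos.2 h0
  have hN2 : N ^ 2 = t ^ 2 + r ^ 2 := Real.sq_sqrt h0.le
  have s2 : √2 ^ 2 = (2 : ℝ) := Real.sq_sqrt (by norm_num)
  have s2' : (1.414 : ℝ) ≤ √2 := Real.le_sqrt_of_sq_le (by norm_num)
  suffices h : |4 * π * conjKernel τ t r| ≤ 3 * √2 / N by
    rw [abs_mul, abs_of_pos (by positivity : 0 < 4 * π)] at h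
    rw [mul_comm (4 * π) N, ← div_div, le_div_iff₀ (by positivity)]
    linarith
  rcases lt_or_ge 0 t with ht | ht
  · have hlim := (tendsto_integral_conjKernel ht τ r).abs
    have b1 : |4 * π * conjKernel τ t r| ≤ 1 / t := by
      refine le_of_tendsto hlim ?_
      filter_upwards [Filter.eventually_ge_atTop τ] with T hT
      exact abs_integral_mul_exp_le_inv (fun x => abs_besselJ0_le_one _) hT ht
    rcases le_total r t with hrt | hrt
    · refine b1.trans ?_
      rw [div_le_div_iff₀ ht hN0, one_mul]
      have : N ≤ √2 * t := abs_le_of_sq_le_sq' (by rw [hN2, mul_pow, s2]; nlinarith)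
        (by positivity) |>.2
      nlinarith
    · have hr' : 0 < r := ht.trans_le hrt
      have b2 : |4 * π * conjKernel τ t r| ≤ 3 / r := by
        refine le_of_tendsto hlim ?_
        filter_upwards [Filter.eventually_ge_atTop τ] with T hT
        refine abs_integral_mul_exp_le (continuous_besselJ0.comp (continuous_const_mul r)) hT ht.le
          fun x hx => abs_integral_besselJ0_mul_le hr' hτ hx.1
      refine b2.trans ?_
      rw [div_le_div_iff₀ hr' hN0]
      have : N ≤ √2 * r := abs_le_of_sq_le_sq' (by rw [hN2, mul_pow, s2]; nlinarith)
        (by positivity) |>.2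
      nlinarith
  · rw [conjKernel_eq_sub_integral]
    set I := ∫ u in (0 : ℝ)..τ, besselJ0 (r * (τ - u)) * Real.exp (-(-t * (u - 0))) with hI
    have hexp : |Real.exp (τ * t) * N⁻¹| ≤ 1 / N := by
      rw [abs_of_pos (by positivity), one_div]
      exact mul_le_of_le_one_left (by positivity)
        (Real.exp_le_one_iff.2 (mul_nonpos_of_nonneg_of_nonpos hτ ht))
    have main : |I| ≤ (3 * √2 - 1) / N := by
      rcases le_total (N / 3) (-t) with hc | hc
      · have ht' : 0 < -t := by linarith [div_pos hN0 (by norm_num : (0 : ℝ) < 3)]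
        refine (abs_integral_mul_exp_le_inv (fun x => abs_besselJ0_le_one _) hτ ht').trans ?_
        rw [div_le_div_iff₀ ht' hN0]
        nlinarith
      · have hr3 : N * (2.82 / 3) ≤ r := abs_le_of_sq_le_sq' (by nlinarith) hr |>.2
        have hr' : 0 < r := lt_of_lt_of_le (by positivity) hr3
        have : |I| ≤ 3 / r := by
          refine abs_integral_mul_exp_le (continuous_besselJ0.comp (by fun_prop)) hτ
            (neg_nonneg.2 ht) fun x hx => ?_
          have h := intervalIntegral.integral_comp_sub_left (a := 0) (b := x)
            (fun ρ => besselJ0 (r * ρ)) τ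
          rw [sub_zero] at h
          simp only [Function.comp_apply]
          rw [h]
          exact abs_integral_besselJ0_mul_le hr' (by linarith [hx.2]) (by linarith [hx.1])
        refine this.trans ?_
        rw [div_le_div_iff₀ hr' hN0]
        nlinarith
    calc |Real.exp (τ * t) * N⁻¹ - I| ≤ |Real.exp (τ * t) * N⁻¹| + |I| := abs_sub _ _
      _ ≤ 1 / N + (3 * √2 - 1) / N := add_le_add hexp main
      _ = 3 * √2 / N := by ring

theorem continuousOn_conjKernel (τ : ℝ) :
    ContinuousOn (fun x : ℝ × ℝ => conjKernel τ x.1 x.2) {x | 0 < x.1 ^ 2 + x.2 ^ 2} := by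
  unfold conjKernel
  refine ContinuousOn.mul (by fun_prop) (ContinuousOn.sub ?_ ?_)
  · exact ContinuousOn.inv₀ (by fun_prop) fun x hx => (Real.sqrt_pos.2 hx).ne'
  · refine Continuous.continuousOn ?_
    refine intervalIntegral.continuous_parametric_intervalIntegral_of_continuous'
      (f := fun (x : ℝ × ℝ) ρ => besselJ0 (x.2 * ρ) * Real.exp (-(x.1 * ρ))) ?_ 0 τ
    exact (continuous_besselJ0.comp (by fun_prop)).mul (by fun_prop)

/-- The radial integral whose value is the kernel: for `t ≠ 0` the kernel is the Fourier transform
in the plane of a radial function. -/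
theorem integral_exp_sub_mul_besselJ0 {τ t : ℝ} (hτ : 0 ≤ τ) (ht : t ≠ 0) (r : ℝ) :
    ∫ ρ in Set.Ioi (0 : ℝ), Real.exp (τ * t) * (Real.exp (-(|t| * ρ)) -
      if ρ < τ then Real.exp (-(t * ρ)) else 0) * besselJ0 (r * ρ) = 4 * π * conjKernel τ t r := by
  have ht' : 0 < |t| := abs_pos.2 ht
  have h1 := integrableOn_exp_mul_besselJ0 ht' r 0
  have hi : Set.indicator (Set.Iio τ) (fun ρ => besselJ0 (r * ρ) * Real.exp (-(t * ρ))) =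
      fun ρ => (if ρ < τ then Real.exp (-(t * ρ)) else 0) * besselJ0 (r * ρ) := by
    ext ρ
    simp only [Set.indicator, Set.mem_Iio]
    split_ifs <;> ring
  have hc : Continuous fun ρ : ℝ => besselJ0 (r * ρ) * Real.exp (-(t * ρ)) :=
    (continuous_besselJ0.comp (continuous_const_mul r)).mul (by fun_prop)
  have h2 : ∫ ρ in Set.Ioi (0 : ℝ), (if ρ < τ then Real.exp (-(t * ρ)) else 0) * besselJ0 (r * ρ) =
      ∫ ρ in (0 : ℝ)..τ, besselJ0 (r * ρ) * Real.exp (-(t * ρ)) := by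
    rw [← hi, setIntegral_indicator measurableSet_Iio, Set.Ioi_inter_Iio,
      ← integral_Ioc_eq_integral_Ioo, intervalIntegral.integral_of_le hτ]
  have h3 : IntegrableOn (fun ρ => (if ρ < τ then Real.exp (-(t * ρ)) else 0) * besselJ0 (r * ρ))
      (Set.Ioi 0) := by
    rw [← hi, integrableOn_indicator_iff measurableSet_Iio, Set.inter_comm, Set.Ioi_inter_Iio]
    exact (hc.continuousOn.integrableOn_Icc (a := 0) (b := τ)).mono_set Set.Ioo_subset_Icc_self
  simp only [sub_mul, mul_sub, mul_assoc]
  rw [integral_sub (h1.const_mul _) (h3.const_mul _), integral_const_mul, integral_const_mul,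
    integral_exp_mul_besselJ0 ht', h2, conjKernel, sq_abs]
  field_simp

/-! ### The Fourier transform along the distinguished axis -/

/-- The inverse Fourier transform of `s ↦ 1 / (s² + ρ² + 2iτs - τ²)`, for `ρ > 0`, `τ ≥ 0` and
`ρ ≠ τ`. -/
noncomputable def axisKernel (τ ρ t : ℝ) : ℝ :=
  Real.exp (τ * t) * (Real.exp (-(|t| * ρ)) - if ρ < τ then Real.exp (-(t * ρ)) else 0) / (2 * ρ)

theorem measurable_axisKernel (τ : ℝ) : Measurable fun x : ℝ × ℝ => axisKernel τ x.1 x.2 := by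
  unfold axisKernel
  refine Measurable.div (Measurable.mul (by fun_prop) (Measurable.sub (by fun_prop) ?_))
    (by fun_prop)
  exact Measurable.ite (measurableSet_lt measurable_fst measurable_const) (by fun_prop)
    measurable_const

theorem abs_axisKernel_le {τ ρ : ℝ} (hτ : 0 ≤ τ) (hρ : 0 < ρ) (t : ℝ) :
    |axisKernel τ ρ t| ≤ 1 / (2 * ρ) := by
  rw [axisKernel, abs_div, abs_of_pos (by positivity : 0 < 2 * ρ)]
  gcongr
  rw [mul_sub, mul_ite, ← Real.exp_add, ← Real.exp_add, mul_zero]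
  rcases le_or_gt 0 t with ht | ht
  · rw [abs_of_nonneg ht]
    split_ifs with h
    · simp
    · rw [sub_zero, abs_of_pos (Real.exp_pos _), Real.exp_le_one_iff]
      nlinarith
  · rw [abs_of_neg ht]
    have h1 : Real.exp (τ * t + -(-t * ρ)) ≤ 1 := Real.exp_le_one_iff.2 (by nlinarith)
    have h1' := Real.exp_pos (τ * t + -(-t * ρ))
    split_ifs with h
    · have h2 : Real.exp (τ * t + -(t * ρ)) ≤ 1 := Real.exp_le_one_iff.2 (by nlinarith)
      have h2' := Real.exp_pos (τ * t + -(t * ρ))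
      rw [abs_le]; constructor <;> linarith
    · rwa [sub_zero, abs_of_pos h1']

theorem axisKernel_transform {τ ρ : ℝ} (hτ : 0 ≤ τ) (hρ : 0 < ρ) (hne : ρ ≠ τ) (s : ℝ) :
    Integrable (fun t : ℝ => Complex.exp (-(Complex.I * (t * s : ℝ))) * axisKernel τ ρ t) ∧
    ∫ t : ℝ, Complex.exp (-(Complex.I * (t * s : ℝ))) * axisKernel τ ρ t =
      (((s ^ 2 + ρ ^ 2 : ℝ) : ℂ) + 2 * Complex.I * τ * s - (τ : ℂ) ^ 2)⁻¹ := by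
  set F := fun t : ℝ => Complex.exp (-(Complex.I * (t * s : ℝ))) * axisKernel τ ρ t with hF
  set c₁ : ℂ := τ + ρ - Complex.I * s with hc₁
  set c₂ : ℂ := τ - ρ - Complex.I * s with hc₂
  have r₁ : c₁.re = τ + ρ := by simp [hc₁]
  have r₂ : c₂.re = τ - ρ := by simp [hc₂]
  have hρ' : (ρ : ℂ) ≠ 0 := by exact_mod_cast hρ.ne'
  have n₁ : c₁ ≠ 0 := fun h => by rw [h, Complex.zero_re] at r₁; linarith
  have n₂ : c₂ ≠ 0 := fun h => by
    rw [h, Complex.zero_re] at r₂; exact hne (by linarith)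
  have hsymb : ((s ^ 2 + ρ ^ 2 : ℝ) : ℂ) + 2 * Complex.I * τ * s - (τ : ℂ) ^ 2 = -(c₁ * c₂) := by
    rw [hc₁, hc₂]; push_cast; linear_combination ((s : ℂ) ^ 2) * Complex.I_sq
  have hIic : IntegrableOn (fun t : ℝ => Complex.exp (c₁ * t)) (Set.Iic 0) :=
    integrableOn_exp_mul_complex_Iic (by rw [r₁]; linarith) 0
  have vIic : ∫ t : ℝ in Set.Iic 0, Complex.exp (c₁ * t) = 1 / c₁ := by
    rw [integral_exp_mul_complex_Iic (by rw [r₁]; linarith)]; simp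
  rw [hsymb]
  rcases hne.lt_or_gt with h | h
  · have e1 : Set.EqOn (fun t : ℝ => (2 * ρ : ℂ)⁻¹ * (Complex.exp (c₁ * t) - Complex.exp (c₂ * t)))
        F (Set.Iic 0) := by
      intro t ht
      simp only [hF, axisKernel, if_pos h, abs_of_nonpos (Set.mem_Iic.1 ht)]
      push_cast
      rw [mul_sub (Complex.exp (τ * t)), ← Complex.exp_add, ← Complex.exp_add, mul_div_assoc',
        mul_sub (Complex.exp (-_)), ← Complex.exp_add, ← Complex.exp_add, inv_mul_eq_div]
      congr 3 <;> simp only [hc₁, hc₂] <;> ring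
    have e2 : Set.EqOn (fun _ : ℝ => (0 : ℂ)) F (Set.Ioi 0) := by
      intro t ht
      simp [hF, axisKernel, if_pos h, abs_of_pos (Set.mem_Ioi.1 ht)]
    have hIic2 : IntegrableOn (fun t : ℝ => Complex.exp (c₂ * t)) (Set.Iic 0) :=
      integrableOn_exp_mul_complex_Iic (by rw [r₂]; linarith) 0
    have vIic2 : ∫ t : ℝ in Set.Iic 0, Complex.exp (c₂ * t) = 1 / c₂ := by
      rw [integral_exp_mul_complex_Iic (by rw [r₂]; linarith)]; simp
    have i1 : IntegrableOn F (Set.Iic 0) :=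
      IntegrableOn.congr_fun ((hIic.sub hIic2).const_mul _) e1 measurableSet_Iic
    have i2 : IntegrableOn F (Set.Ioi 0) :=
      IntegrableOn.congr_fun integrableOn_zero e2 measurableSet_Ioi
    refine ⟨by rw [← integrableOn_univ, ← Set.Iic_union_Ioi (a := (0 : ℝ))]; exact i1.union i2, ?_⟩
    rw [← intervalIntegral.integral_Iic_add_Ioi i1 i2,
      ← setIntegral_congr_fun measurableSet_Iic e1, ← setIntegral_congr_fun measurableSet_Ioi e2,
      integral_const_mul, integral_sub hIic hIic2, vIic, vIic2, integral_zero, add_zero]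
    have : (2 * ρ : ℂ) = c₁ - c₂ := by simp only [hc₁, hc₂]; ring
    have h3 : c₁ - c₂ ≠ 0 := by rw [← this]; simpa using hρ'
    rw [this]
    field_simp
    ring
  · have e1 : Set.EqOn (fun t : ℝ => (2 * ρ : ℂ)⁻¹ * Complex.exp (c₁ * t)) F (Set.Iic 0) := by
      intro t ht
      simp only [hF, axisKernel, if_neg h.not_gt, abs_of_nonpos (Set.mem_Iic.1 ht), sub_zero]
      push_cast
      rw [← Complex.exp_add, mul_div_assoc', ← Complex.exp_add, inv_mul_eq_div]
      congr 2; simp only [hc₁]; ring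
    have e2 : Set.EqOn (fun t : ℝ => (2 * ρ : ℂ)⁻¹ * Complex.exp (c₂ * t)) F (Set.Ioi 0) := by
      intro t ht
      simp only [hF, axisKernel, if_neg h.not_gt, abs_of_pos (Set.mem_Ioi.1 ht), sub_zero]
      push_cast
      rw [← Complex.exp_add, mul_div_assoc', ← Complex.exp_add, inv_mul_eq_div]
      congr 2; simp only [hc₂]; ring
    have hIoi : IntegrableOn (fun t : ℝ => Complex.exp (c₂ * t)) (Set.Ioi 0) :=
      integrableOn_exp_mul_complex_Ioi (by rw [r₂]; linarith) 0
    have vIoi : ∫ t : ℝ in Set.Ioi 0, Complex.exp (c₂ * t) = -1 / c₂ := by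
      rw [integral_exp_mul_complex_Ioi (by rw [r₂]; linarith)]; simp
    have i1 : IntegrableOn F (Set.Iic 0) :=
      IntegrableOn.congr_fun (hIic.const_mul _) e1 measurableSet_Iic
    have i2 : IntegrableOn F (Set.Ioi 0) :=
      IntegrableOn.congr_fun (hIoi.const_mul _) e2 measurableSet_Ioi
    refine ⟨by rw [← integrableOn_univ, ← Set.Iic_union_Ioi (a := (0 : ℝ))]; exact i1.union i2, ?_⟩
    rw [← intervalIntegral.integral_Iic_add_Ioi i1 i2,
      ← setIntegral_congr_fun measurableSet_Iic e1, ← setIntegral_congr_fun measurableSet_Ioi e2,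
      integral_const_mul, integral_const_mul, vIic, vIoi]
    have : (2 * ρ : ℂ) = c₁ - c₂ := by simp only [hc₁, hc₂]; ring
    have h3 : c₁ - c₂ ≠ 0 := by rw [← this]; simpa using hρ'
    rw [this]
    field_simp
    ring

theorem integrable_axisKernel {τ ρ : ℝ} (hτ : 0 ≤ τ) (hρ : 0 < ρ) (hne : ρ ≠ τ) :
    Integrable (axisKernel τ ρ) := by
  have h := (axisKernel_transform hτ hρ hne 0).1
  simp only [mul_zero, Complex.ofReal_zero, neg_zero, Complex.exp_zero, one_mul] at h
  exact h.re

/-! ### Integrability of weights -/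

theorem integrable_inv_one_add_norm_pow {E : Type*} [NormedAddCommGroup E] [NormedSpace ℝ E]
    [FiniteDimensional ℝ E] [MeasurableSpace E] [BorelSpace E] (μ : Measure E)
    [μ.IsAddHaarMeasure] {k : ℕ} (hk : Module.finrank ℝ E < k) :
    Integrable (fun x : E => ((1 + ‖x‖) ^ k)⁻¹) μ := by
  have h := integrable_one_add_norm (E := E) (μ := μ) (r := k) (by exact_mod_cast hk)
  refine h.congr (Filter.Eventually.of_forall fun x => ?_)
  simp only
  rw [Real.rpow_neg (by positivity), Real.rpow_natCast]

theorem integrable_inv_sqrt_abs_sub_mul (c : ℝ) :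
    Integrable fun s : ℝ => (√|s - c|)⁻¹ * ((1 + |s|) ^ 2)⁻¹ := by
  have h1 : Integrable fun s : ℝ => ((1 + |s|) ^ 2)⁻¹ := by
    simpa using integrable_inv_one_add_norm_pow (volume : Measure ℝ) (k := 2) (by simp)
  have h2 : IntegrableOn (fun s : ℝ => (√|s|)⁻¹) (Metric.ball 0 1) := by
    have := (integrableOn_fun_norm_addHaar (E := ℝ) volume (f := fun y => (√y)⁻¹) (r := 1)).2 ?_
    · simpa using this
    · have h := (intervalIntegral.integrableOn_Ioo_rpow_iff (s := -(1 / 2)) one_pos).2 (by norm_num)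
      refine h.congr_fun (fun y hy => ?_) measurableSet_Ioo
      simp [Real.sqrt_eq_rpow, Real.rpow_neg hy.1.le]
  have h3 : Integrable fun s : ℝ =>
      (Metric.ball (0 : ℝ) 1).indicator (fun s : ℝ => (√|s|)⁻¹) (s - c) :=
    ((integrable_indicator_iff measurableSet_ball).2 h2).comp_sub_right c
  refine (h3.add h1).mono' (by fun_prop) (Filter.Eventually.of_forall fun s => ?_)
  rw [Real.norm_of_nonneg (by positivity), Pi.add_apply]
  have hp : ((1 + |s|) ^ 2)⁻¹ ≤ 1 := inv_le_one_of_one_le₀ (one_le_pow₀ (by linarith [abs_nonneg s]))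
  by_cases hs : s - c ∈ Metric.ball (0 : ℝ) 1
  · rw [Set.indicator_of_mem hs]
    have : (√|s - c|)⁻¹ * ((1 + |s|) ^ 2)⁻¹ ≤ (√|s - c|)⁻¹ :=
      mul_le_of_le_one_right (by positivity) hp
    have : 0 ≤ ((1 + |s|) ^ 2)⁻¹ := by positivity
    linarith
  · rw [Set.indicator_of_notMem hs, zero_add]
    refine mul_le_of_le_one_left (by positivity) (inv_le_one_of_one_le₀ (Real.one_le_sqrt.2 ?_))
    simpa using hs

theorem integrable_inv_norm_mul_inv_sqrt (τ : ℝ) :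
    Integrable fun ζ : ℂ => ‖ζ‖⁻¹ * ((√|‖ζ‖ - τ|)⁻¹ * ((1 + ‖ζ‖) ^ 2)⁻¹) := by
  refine (integrable_fun_norm_addHaar (E := ℂ) volume
    (f := fun y => y⁻¹ * ((√|y - τ|)⁻¹ * ((1 + y) ^ 2)⁻¹))).2 ?_
  refine ((integrable_inv_sqrt_abs_sub_mul τ).integrableOn (s := Set.Ioi 0)).congr_fun
    (fun y hy => ?_) measurableSet_Ioi
  have hy : 0 < y := hy
  simp only [Complex.finrank_real_complex, abs_of_pos hy, smul_eq_mul]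
  field_simp
  norm_num

theorem integrable_inv_norm_mul_inv_pow :
    Integrable fun ζ : ℂ => ‖ζ‖⁻¹ * ((1 + ‖ζ‖) ^ 2)⁻¹ := by
  refine (integrable_fun_norm_addHaar (E := ℂ) volume
    (f := fun y => y⁻¹ * ((1 + y) ^ 2)⁻¹)).2 ?_
  have h1 : Integrable fun s : ℝ => ((1 + ‖s‖) ^ 2)⁻¹ :=
    integrable_inv_one_add_norm_pow (volume : Measure ℝ) (k := 2) (by simp)
  refine (h1.integrableOn (s := Set.Ioi 0)).congr_fun (fun y hy => ?_) measurableSet_Ioi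
  have hy : 0 < y := hy
  simp only [Complex.finrank_real_complex, Real.norm_of_nonneg hy.le, smul_eq_mul]
  field_simp
  norm_num

theorem integrable_inv_norm_mul_inv_pow_E3 :
    Integrable fun x : E3 => ‖x‖⁻¹ * ((1 + ‖x‖) ^ 8)⁻¹ := by
  refine (integrable_fun_norm_addHaar (E := E3) volume
    (f := fun y => y⁻¹ * ((1 + y) ^ 8)⁻¹)).2 ?_
  have h1 : Integrable fun s : ℝ => ((1 + ‖s‖) ^ 2)⁻¹ :=
    integrable_inv_one_add_norm_pow (volume : Measure ℝ) (k := 2) (by simp)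
  refine Integrable.mono' (h1.integrableOn (s := Set.Ioi 0))
    (by fun_prop) (ae_restrict_of_forall_mem measurableSet_Ioi fun y hy => ?_)
  have hy : 0 < y := hy
  simp only [finrank_euclideanSpace, Fintype.card_fin, smul_eq_mul, Real.norm_of_nonneg hy.le]
  rw [Real.norm_of_nonneg (by positivity), ← mul_assoc, ← div_eq_mul_inv,
    div_le_iff₀ (by positivity), show (1 + y) ^ 8 = (1 + y) ^ 2 * (1 + y) ^ 6 by ring,
    inv_mul_cancel_left₀ (by positivity)]
  calc y ^ (3 - 1) * y⁻¹ = y := by field_simp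
    _ ≤ 1 + y := by linarith
    _ ≤ (1 + y) ^ 6 := le_self_pow₀ (by linarith) (by norm_num)

/-! ### Coordinates along and across the distinguished axis -/

/-- The isometry `ℝ × ℂ → ℝ³` whose first component is the coordinate along the axis. -/
noncomputable def axisIsometry : WithLp 2 (ℝ × ℂ) ≃ₗᵢ[ℝ] E3 where
  toFun q := !₂[q.fst, q.snd.re, q.snd.im]
  invFun x := WithLp.toLp 2 (x 0, ⟨x 1, x 2⟩)
  left_inv _ := rfl
  right_inv x := by ext i; fin_cases i <;> simp
  map_add' p q := by ext i; fin_cases i <;> simp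
  map_smul' c q := by ext i; fin_cases i <;> simp
  norm_map' q := by
    change ‖(!₂[q.fst, q.snd.re, q.snd.im] : E3)‖ = ‖q‖
    rw [← sq_eq_sq₀ (norm_nonneg _) (norm_nonneg _), WithLp.prod_norm_sq_eq_of_L2,
      EuclideanSpace.norm_sq_eq, Fin.sum_univ_three, Complex.sq_norm, Complex.normSq_apply]
    simp [← sq]
    ring

/-- The coordinates of `axisIsometry` as a measurable equivalence on the plain product. -/
noncomputable def axisEquiv : ℝ × ℂ ≃ᵐ E3 :=
  (MeasurableEquiv.toLp 2 (ℝ × ℂ)).trans axisIsometry.toMeasurableEquiv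

theorem axisEquiv_eq (q : ℝ × ℂ) : axisEquiv q = axisIsometry (WithLp.toLp 2 q) := rfl

theorem measurePreserving_axisEquiv : MeasurePreserving axisEquiv :=
  (WithLp.volume_preserving_toLp ℝ ℂ).trans axisIsometry.measurePreserving

theorem axisEquiv_zero (q : ℝ × ℂ) : axisEquiv q 0 = q.1 := rfl

theorem continuous_axisEquiv : Continuous axisEquiv :=
  axisIsometry.continuous.comp (WithLp.prod_continuous_toLp 2 ℝ ℂ)

theorem norm_axisEquiv_sq (q : ℝ × ℂ) : ‖axisEquiv q‖ ^ 2 = q.1 ^ 2 + ‖q.2‖ ^ 2 := by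
  rw [axisEquiv_eq, LinearIsometryEquiv.norm_map, WithLp.prod_norm_sq_eq_of_L2]
  simp

theorem inner_axisEquiv (p q : ℝ × ℂ) :
    inner ℝ (axisEquiv p) (axisEquiv q) = p.1 * q.1 + inner ℝ p.2 q.2 := by
  rw [axisEquiv_eq, axisEquiv_eq, LinearIsometryEquiv.inner_map_map, WithLp.prod_inner_apply]
  simp [mul_comm]

theorem inv_one_add_norm_axisEquiv_le (q : ℝ × ℂ) (k : ℕ) :
    ((1 + ‖axisEquiv q‖) ^ (2 * k))⁻¹ ≤ ((1 + |q.1|) ^ k)⁻¹ * ((1 + ‖q.2‖) ^ k)⁻¹ := by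
  have h := norm_axisEquiv_sq q
  have h1 : |q.1| ≤ ‖axisEquiv q‖ := abs_le_of_sq_le_sq (by nlinarith) (norm_nonneg _)
  have h2 : ‖q.2‖ ≤ ‖axisEquiv q‖ := by
    rw [← abs_of_nonneg (norm_nonneg q.2)]
    exact abs_le_of_sq_le_sq (by nlinarith) (norm_nonneg _)
  rw [← mul_inv, two_mul, pow_add]
  gcongr

/-! ### Local integrability of the reciprocal symbol -/

theorem continuous_conjSymbol (τ : ℝ) : Continuous (conjSymbol τ) := by
  unfold conjSymbol
  fun_prop

theorem conjSymbol_axisEquiv (τ s : ℝ) (ζ : ℂ) : conjSymbol τ (axisEquiv (s, ζ)) =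
    ((s ^ 2 + ‖ζ‖ ^ 2 : ℝ) : ℂ) + 2 * Complex.I * τ * s - (τ : ℂ) ^ 2 := by
  rw [conjSymbol, norm_axisEquiv_sq, axisEquiv_zero]

/-- The factorization `p_τ = (ρ + τ - is)(ρ - τ + is)` with `ρ = |ζ|` bounds the symbol below, up to
constants, by `ρ √|ρ - τ| √|s|`, whose reciprocal is locally integrable. -/
theorem le_norm_conjSymbol {τ : ℝ} (hτ : 0 ≤ τ) (s : ℝ) (ζ : ℂ) :
    ‖ζ‖ * (√|‖ζ‖ - τ| * √|s|) ≤ ‖conjSymbol τ (axisEquiv (s, ζ))‖ := by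
  have hf : conjSymbol τ (axisEquiv (s, ζ)) =
      ((‖ζ‖ + τ : ℝ) + (-s : ℝ) * Complex.I) * ((‖ζ‖ - τ : ℝ) + (s : ℝ) * Complex.I) := by
    rw [conjSymbol_axisEquiv]; push_cast; linear_combination ((s : ℂ) ^ 2) * Complex.I_sq
  rw [hf, norm_mul]
  refine mul_le_mul ?_ ?_ (by positivity) (norm_nonneg _)
  · refine le_trans ?_ (Complex.re_le_norm _)
    simp [hτ]
  · rw [Complex.norm_add_mul_I, ← Real.sqrt_mul (abs_nonneg _)]
    refine Real.sqrt_le_sqrt ?_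
    rw [← sq_abs (‖ζ‖ - τ), ← sq_abs s]
    nlinarith [sq_nonneg (|‖ζ‖ - τ| - |s|), abs_nonneg (‖ζ‖ - τ), abs_nonneg s,
      mul_nonneg (abs_nonneg (‖ζ‖ - τ)) (abs_nonneg s)]

theorem ae_norm_pos_and_ne (τ : ℝ) : ∀ᵐ ζ : ℂ, 0 < ‖ζ‖ ∧ ‖ζ‖ ≠ τ := by
  have h1 : ∀ᵐ ζ : ℂ, ζ ∉ Metric.sphere (0 : ℂ) τ :=
    measure_eq_zero_iff_ae_notMem.1 (Measure.addHaar_sphere volume 0 τ)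
  have h2 : ∀ᵐ ζ : ℂ, ζ ∉ ({0} : Set ℂ) := measure_eq_zero_iff_ae_notMem.1 (by simp)
  filter_upwards [h1, h2] with ζ h1 h2
  refine ⟨norm_pos_iff.2 h2, fun h => h1 (by simpa using h)⟩

theorem integrable_inv_conjSymbol_mul {τ : ℝ} (hτ : 0 ≤ τ) :
    Integrable fun ξ : E3 => (conjSymbol τ ξ)⁻¹ * (((1 + ‖ξ‖) ^ 8)⁻¹ : ℝ) := by
  rw [← measurePreserving_axisEquiv.integrable_comp_emb axisEquiv.measurableEmbedding]
  have h := (integrable_inv_sqrt_abs_sub_mul 0).mul_prod (integrable_inv_norm_mul_inv_sqrt τ)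
  refine h.mono' ?_ ?_
  · refine Measurable.aestronglyMeasurable ?_
    refine Measurable.comp ?_ axisEquiv.measurable
    exact (continuous_conjSymbol τ).measurable.inv.mul (by fun_prop)
  · have hae : ∀ᵐ q : ℝ × ℂ, 0 < ‖q.2‖ ∧ ‖q.2‖ ≠ τ :=
      Measure.quasiMeasurePreserving_snd.ae (ae_norm_pos_and_ne τ)
    have hae' : ∀ᵐ q : ℝ × ℂ, q.1 ≠ 0 :=
      Measure.quasiMeasurePreserving_fst.ae (Measure.ae_ne volume (0 : ℝ))
    filter_upwards [hae, hae'] with q h1 h2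
    have hlow := le_norm_conjSymbol hτ q.1 q.2
    have p1 : 0 < √|‖q.2‖ - τ| := Real.sqrt_pos.2 (abs_pos.2 (sub_ne_zero.2 h1.2))
    have p2 : 0 < √|q.1| := Real.sqrt_pos.2 (abs_pos.2 h2)
    have p3 := h1.1
    rw [Function.comp_apply, norm_mul, norm_inv, Complex.norm_real,
      Real.norm_of_nonneg (by positivity)]
    calc ‖conjSymbol τ (axisEquiv q)‖⁻¹ * ((1 + ‖axisEquiv q‖) ^ 8)⁻¹
        ≤ (‖q.2‖ * (√|‖q.2‖ - τ| * √|q.1|))⁻¹ *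
          (((1 + |q.1|) ^ 2)⁻¹ * ((1 + ‖q.2‖) ^ 2)⁻¹) := by
          refine mul_le_mul (inv_anti₀ (by positivity) hlow) ?_ (by positivity) (by positivity)
          refine le_trans ?_ (inv_one_add_norm_axisEquiv_le q 2)
          gcongr <;> simp
      _ = _ := by rw [sub_zero, mul_inv, mul_inv]; ring

/-! ### Fourier integrals on the line and in the plane -/

theorem fourier_inversion_line {F h : ℝ → ℂ} (hF : Continuous F) (hFi : Integrable F)
    (hh : Integrable h)
    (H : ∀ s : ℝ, h s = (2 * π : ℂ)⁻¹ * ∫ t : ℝ, Complex.exp (Complex.I * (t * s : ℝ)) * F t)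
    (t : ℝ) : F t = ∫ s : ℝ, Complex.exp (-(Complex.I * (t * s : ℝ))) * h s := by
  have hpi : (2 * π : ℂ) ≠ 0 := by exact_mod_cast Real.two_pi_pos.ne'
  have h1 : 𝓕⁻ F = fun y => (2 * π : ℂ) * h (2 * π * y) := by
    ext y
    rw [H, mul_inv_cancel_left₀ hpi, Real.fourierInv_eq']
    refine integral_congr_ae (Filter.Eventually.of_forall fun v => ?_)
    simp only [smul_eq_mul, RCLike.inner_apply, conj_trivial]
    congr 2
    push_cast
    ring
  have h2 : Integrable (𝓕 F) := by
    have e : 𝓕 F = fun y => (2 * π : ℂ) * h (-(2 * π) * y) := by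
      ext y
      have h3 := Real.fourierInv_eq_fourier_neg F (-y)
      rw [neg_neg] at h3
      rw [← h3, h1]
      simp
    rw [e]
    exact (hh.comp_mul_left' (neg_ne_zero.2 Real.two_pi_pos.ne')).const_mul _
  have h3 := congrFun (hF.fourier_fourierInv_eq hFi h2) t
  rw [← h3, Real.fourier_eq', h1]
  have h4 := Measure.integral_comp_mul_left
    (fun s : ℝ => Complex.exp (-(Complex.I * (t * s : ℝ))) * h s) (2 * π)
  rw [abs_of_pos (inv_pos.2 Real.two_pi_pos), Complex.real_smul,
    ← mul_right_inj' hpi, ← mul_assoc] at h4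
  push_cast at h4
  rw [mul_inv_cancel₀ hpi, one_mul] at h4
  push_cast
  rw [← h4, ← integral_const_mul]
  refine integral_congr_ae (Filter.Eventually.of_forall fun v => ?_)
  simp only [smul_eq_mul, RCLike.inner_apply, conj_trivial]
  rw [mul_left_comm]
  congr 3
  push_cast
  ring

theorem norm_cexp_I_mul (x : ℝ) : ‖Complex.exp (Complex.I * x)‖ = 1 := by
  rw [mul_comm, Complex.norm_exp_ofReal_mul_I]

theorem norm_cexp_neg_I_mul (x : ℝ) : ‖Complex.exp (-(Complex.I * x))‖ = 1 := by
  rw [Complex.exp_neg, norm_inv, norm_cexp_I_mul, inv_one]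

/-- The Fourier transform of a radial function in the plane is a Hankel transform. -/
theorem integral_radial_mul_cexp {G : ℝ → ℝ}
    (hG : IntegrableOn (fun y => y * G y) (Set.Ioi 0)) (ζ : ℂ) :
    ∫ ω : ℂ, (G ‖ω‖ : ℂ) * Complex.exp (Complex.I * (inner ℝ ζ ω : ℝ)) =
      2 * π * ((∫ y in Set.Ioi (0 : ℝ), y * G y * besselJ0 (‖ζ‖ * y) : ℝ) : ℂ) := by
  -- A rotation moves `ζ` to the positive real axis.
  set u : Circle := Circle.exp (Complex.arg ζ) with hu
  have hrot : ∫ ω : ℂ, (G ‖ω‖ : ℂ) * Complex.exp (Complex.I * (inner ℝ ζ ω : ℝ)) =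
      ∫ ω : ℂ, (G ‖ω‖ : ℂ) * Complex.exp (Complex.I * (‖ζ‖ * ω.re : ℝ)) := by
    rw [← (rotation u).measurePreserving.integral_comp
      (rotation u).toMeasurableEquiv.measurableEmbedding]
    refine integral_congr_ae (Filter.Eventually.of_forall fun ω => ?_)
    simp only [LinearIsometryEquiv.norm_map]
    congr 4
    have hζ : ζ = rotation u (‖ζ‖ : ℂ) := by
      rw [rotation_apply, hu, Circle.coe_exp, mul_comm, Complex.norm_mul_exp_arg_mul_I]
    conv_lhs => rw [hζ]
    rw [LinearIsometryEquiv.inner_map_map, Complex.inner]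
    simp [mul_comm]
  have hprod : Integrable (fun p : ℝ × ℝ => (p.1 * G p.1 : ℂ) *
      Complex.exp (Complex.I * (‖ζ‖ * (p.1 * Real.cos p.2) : ℝ)))
      ((volume.restrict (Set.Ioi 0)).prod (volume.restrict (Set.Ioo (-π) π))) := by
    have h1 : Integrable (fun _ : ℝ => (1 : ℂ)) (volume.restrict (Set.Ioo (-π) π)) :=
      (continuous_const.integrableOn_Icc (a := -π) (b := π)).mono_set Set.Ioo_subset_Icc_self
    have h2 := hG.ofReal (𝕜 := ℂ)
    refine ((h2.mul_prod h1).bdd_mul (c := 1) (f := fun p : ℝ × ℝ =>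
      Complex.exp (Complex.I * (‖ζ‖ * (p.1 * Real.cos p.2) : ℝ))) ?_ ?_).congr ?_
    · exact Continuous.aestronglyMeasurable (by fun_prop)
    · exact Filter.Eventually.of_forall fun p => (norm_cexp_I_mul _).le
    · refine Filter.Eventually.of_forall fun p => ?_
      simp [mul_comm]
  rw [hrot, ← Complex.integral_comp_polarCoord_symm, polarCoord_target, Measure.volume_eq_prod]
  have hcongr : ∫ p in Set.Ioi (0 : ℝ) ×ˢ Set.Ioo (-π) π, p.1 •
      ((G ‖Complex.polarCoord.symm p‖ : ℂ) *
        Complex.exp (Complex.I * (‖ζ‖ * (Complex.polarCoord.symm p).re : ℝ)))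
        ∂((volume : Measure ℝ).prod volume) =
      ∫ p in Set.Ioi (0 : ℝ) ×ˢ Set.Ioo (-π) π, (p.1 * G p.1 : ℂ) *
        Complex.exp (Complex.I * (‖ζ‖ * (p.1 * Real.cos p.2) : ℝ))
        ∂((volume : Measure ℝ).prod volume) := by
    refine setIntegral_congr_fun (measurableSet_Ioi.prod measurableSet_Ioo) fun p hp => ?_
    have hp1 : (0 : ℝ) < p.1 := hp.1
    have hre : (Complex.polarCoord.symm p).re = p.1 * Real.cos p.2 := by
      rw [Complex.polarCoord_symm_apply, Complex.re_ofReal_mul]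
      simp [-Complex.ofReal_cos, -Complex.ofReal_sin]
    simp only [Complex.norm_polarCoord_symm, abs_of_pos hp1, Complex.real_smul, hre]
    ring
  rw [hcongr, ← Measure.prod_restrict, integral_prod _ hprod, ← integral_complex_ofReal,
    ← integral_const_mul]
  refine integral_congr_ae (Filter.Eventually.of_forall fun y => ?_)
  have h := integral_cexp_mul_cos (‖ζ‖ * y)
  rw [intervalIntegral.integral_of_le (by linarith [Real.pi_pos]),
    integral_Ioc_eq_integral_Ioo] at h
  simp only [← mul_assoc] at h ⊢
  rw [integral_const_mul, h]
  push_cast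
  ring

theorem integrableOn_mul_axisKernel (τ : ℝ) {t : ℝ} (ht : t ≠ 0) :
    IntegrableOn (fun y => y * axisKernel τ y t) (Set.Ioi 0) := by
  have ht' : 0 < |t| := abs_pos.2 ht
  have h1 := integrableOn_exp_mul_Ioi (neg_lt_zero.2 ht') 0
  have h2 : IntegrableOn (Set.indicator (Set.Iio τ) fun y => Real.exp (-(t * y))) (Set.Ioi 0) := by
    rw [integrableOn_indicator_iff measurableSet_Iio, Set.inter_comm, Set.Ioi_inter_Iio]
    exact ((by fun_prop : Continuous fun y : ℝ => Real.exp (-(t * y))).integrableOn_Icc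
      (a := 0) (b := τ)).mono_set Set.Ioo_subset_Icc_self
  refine IntegrableOn.congr_fun ((h1.sub h2).const_mul (Real.exp (τ * t) / 2))
    (fun y hy => ?_) measurableSet_Ioi
  have hy : 0 < y := hy
  simp only [Pi.sub_apply, axisKernel, Set.indicator, Set.mem_Iio, neg_mul]
  field_simp

theorem integrable_axisKernel_norm (τ : ℝ) {t : ℝ} (ht : t ≠ 0) :
    Integrable fun ω : ℂ => axisKernel τ ‖ω‖ t := by
  refine (integrable_fun_norm_addHaar (E := ℂ) volume (f := fun y => axisKernel τ y t)).2 ?_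
  simpa using integrableOn_mul_axisKernel τ ht

theorem integral_axisKernel_mul_cexp {τ t : ℝ} (hτ : 0 ≤ τ) (ht : t ≠ 0) (ζ : ℂ) :
    ∫ ω : ℂ, (axisKernel τ ‖ω‖ t : ℂ) * Complex.exp (Complex.I * (inner ℝ ζ ω : ℝ)) =
      (2 * π) ^ 2 * conjKernel τ t ‖ζ‖ := by
  rw [integral_radial_mul_cexp (G := fun y => axisKernel τ y t)
    (integrableOn_mul_axisKernel τ ht)]
  have h : ∫ y in Set.Ioi (0 : ℝ), y * axisKernel τ y t * besselJ0 (‖ζ‖ * y) =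
      2 * π * conjKernel τ t ‖ζ‖ := by
    have h1 := integral_exp_sub_mul_besselJ0 hτ ht ‖ζ‖
    have h2 : 2 * π * conjKernel τ t ‖ζ‖ = 2⁻¹ * (4 * π * conjKernel τ t ‖ζ‖) := by ring
    rw [h2, ← h1, ← integral_const_mul]
    refine setIntegral_congr_fun measurableSet_Ioi fun y hy => ?_
    have hy : 0 < y := hy
    simp only [axisKernel]
    field_simp
  rw [h]
  push_cast
  ring

/-! ### Parseval's identity for the reciprocal symbol -/

/-- A continuous function bounded by a multiple of `(1 + |x|)⁻⁸`. Unlike the Schwartz space this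
class is visibly stable under multiplication by characters. -/
def IsDecaying (φ : E3 → ℂ) : Prop :=
  Continuous φ ∧ ∃ C : ℝ, 0 ≤ C ∧ ∀ x, ‖φ x‖ ≤ C * ((1 + ‖x‖) ^ 8)⁻¹

/-- `ψ` is the inverse Fourier transform of `φ`, and both decay. -/
structure IsFourierPair (φ ψ : E3 → ℂ) : Prop where
  left : IsDecaying φ
  right : IsDecaying ψ
  eq : ∀ ξ, ψ ξ = (((2 * π : ℝ) ^ 3)⁻¹ : ℂ) *
    ∫ x, Complex.exp (Complex.I * (inner ℝ x ξ : ℝ)) * φ x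

/-- The kernel as a function on `ℝ³`. -/
noncomputable def conjSolution (τ : ℝ) (x : E3) : ℂ :=
  conjKernel τ (axisEquiv.symm x).1 ‖(axisEquiv.symm x).2‖

theorem axisEquiv_symm_sq (x : E3) :
    (axisEquiv.symm x).1 ^ 2 + ‖(axisEquiv.symm x).2‖ ^ 2 = ‖x‖ ^ 2 := by
  rw [← norm_axisEquiv_sq, MeasurableEquiv.apply_symm_apply]

theorem continuousOn_conjSolution (τ : ℝ) : ContinuousOn (conjSolution τ) {0}ᶜ := by
  have hc : Continuous axisEquiv.symm :=
    (WithLp.prod_continuous_ofLp 2 ℝ ℂ).comp axisIsometry.symm.continuous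
  refine Complex.continuous_ofReal.comp_continuousOn ?_
  refine (continuousOn_conjKernel τ).comp (f := fun x : E3 =>
    ((axisEquiv.symm x).1, ‖(axisEquiv.symm x).2‖)) (by fun_prop) fun x hx => ?_
  have hx : x ≠ 0 := hx
  simp only [Set.mem_ofPred_eq, axisEquiv_symm_sq]
  positivity

theorem norm_conjSolution_le {τ : ℝ} (hτ : 0 ≤ τ) {x : E3} (hx : x ≠ 0) :
    ‖conjSolution τ x‖ ≤ 3 * √2 / (4 * π * ‖x‖) := by
  have h := abs_conjKernel_le (t := (axisEquiv.symm x).1) hτ (norm_nonneg (axisEquiv.symm x).2)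
    (by rw [axisEquiv_symm_sq]; positivity)
  rw [axisEquiv_symm_sq, Real.sqrt_sq (norm_nonneg x)] at h
  rwa [conjSolution, Complex.norm_real, Real.norm_eq_abs]

theorem aestronglyMeasurable_of_continuousOn_compl {f : E3 → ℂ} (hf : ContinuousOn f {0}ᶜ) :
    AEStronglyMeasurable f := by
  have h := hf.aestronglyMeasurable (μ := volume) (measurableSet_singleton (0 : E3)).compl
  rwa [restrict_compl_singleton] at h

theorem integrable_mul_of_norm_le {f φ : E3 → ℂ} (hf : ContinuousOn f {0}ᶜ) {A : ℝ}
    (hA : ∀ x, x ≠ 0 → ‖f x‖ ≤ A / ‖x‖) (hφ : IsDecaying φ) :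
    Integrable fun x => f x * φ x := by
  obtain ⟨hc, C, hC, hb⟩ := hφ
  refine (integrable_inv_norm_mul_inv_pow_E3.const_mul (A * C)).mono'
    ((aestronglyMeasurable_of_continuousOn_compl hf).mul hc.aestronglyMeasurable) ?_
  filter_upwards [Measure.ae_ne volume (0 : E3)] with x hx
  rw [norm_mul]
  calc ‖f x‖ * ‖φ x‖ ≤ (A / ‖x‖) * (C * ((1 + ‖x‖) ^ 8)⁻¹) :=
        mul_le_mul (hA x hx) (hb x) (norm_nonneg _) ((norm_nonneg _).trans (hA x hx))
    _ = _ := by ring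

theorem integrable_mul_of_weight {f φ : E3 → ℂ}
    (hf : Integrable fun ξ => f ξ * (((1 + ‖ξ‖) ^ 8)⁻¹ : ℝ)) (hφ : IsDecaying φ) :
    Integrable fun ξ => f ξ * φ ξ := by
  obtain ⟨hc, C, hC, hb⟩ := hφ
  have h : Integrable fun ξ : E3 => (φ ξ * ((1 + ‖ξ‖) ^ 8 : ℝ)) *
      (f ξ * (((1 + ‖ξ‖) ^ 8)⁻¹ : ℝ)) := by
    refine hf.bdd_mul (c := C) (Continuous.aestronglyMeasurable (by fun_prop))
      (Filter.Eventually.of_forall fun ξ => ?_)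
    rw [norm_mul, Complex.norm_real, Real.norm_of_nonneg (by positivity),
      ← le_div_iff₀ (by positivity), div_eq_mul_inv]
    exact hb ξ
  refine h.congr (Filter.Eventually.of_forall fun ξ => ?_)
  have : (((1 + ‖ξ‖) ^ 8 : ℝ) : ℂ) ≠ 0 := by
    exact_mod_cast (by positivity : ((1 + ‖ξ‖) ^ 8 : ℝ) ≠ 0)
  simp only [Complex.ofReal_inv]
  field_simp

theorem IsDecaying.axis {φ : E3 → ℂ} (hφ : IsDecaying φ) :
    Continuous (fun q => φ (axisEquiv q)) ∧ ∃ C : ℝ, 0 ≤ C ∧ ∀ t ζ, ‖φ (axisEquiv (t, ζ))‖ ≤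
      C * (((1 + |t|) ^ 4)⁻¹ * ((1 + ‖ζ‖) ^ 4)⁻¹) := by
  obtain ⟨hc, C, hC, hb⟩ := hφ
  refine ⟨hc.comp continuous_axisEquiv, C, hC, fun t ζ => (hb _).trans ?_⟩
  gcongr
  exact inv_one_add_norm_axisEquiv_le (t, ζ) 4

theorem integrable_inv_one_add_abs_pow_four : Integrable fun t : ℝ => ((1 + |t|) ^ 4)⁻¹ := by
  simpa using integrable_inv_one_add_norm_pow (volume : Measure ℝ) (k := 4) (by simp)

theorem integrable_inv_one_add_norm_pow_four : Integrable fun ζ : ℂ => ((1 + ‖ζ‖) ^ 4)⁻¹ :=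
  integrable_inv_one_add_norm_pow (volume : Measure ℂ) (k := 4) (by simp)

/-- The partial inverse Fourier transform in the variables across the axis. -/
noncomputable def partialFourier (φ : E3 → ℂ) (t : ℝ) (ω : ℂ) : ℂ :=
  ((2 * π : ℂ) ^ 2)⁻¹ *
    ∫ ζ : ℂ, Complex.exp (Complex.I * (inner ℝ ζ ω : ℝ)) * φ (axisEquiv (t, ζ))

theorem continuous_partialFourier {φ : E3 → ℂ} (hφ : IsDecaying φ) :
    Continuous fun q : ℝ × ℂ => partialFourier φ q.1 q.2 := by
  obtain ⟨hc, C, hC, hb⟩ := hφ.axis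
  refine continuous_const.mul ?_
  refine continuous_of_dominated (bound := fun ζ : ℂ => C * ((1 + ‖ζ‖) ^ 4)⁻¹) ?_ ?_ ?_ ?_
  · exact fun q => ((by fun_prop : Continuous fun ζ : ℂ =>
      Complex.exp (Complex.I * (inner ℝ ζ q.2 : ℝ))).mul
      (hc.comp (by fun_prop : Continuous fun ζ : ℂ => (q.1, ζ)))).aestronglyMeasurable
  · refine fun q => Filter.Eventually.of_forall fun ζ => ?_
    rw [norm_mul, norm_cexp_I_mul, one_mul]
    refine (hb _ _).trans ?_
    gcongr
    exact mul_le_of_le_one_left (by positivity)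
      (inv_le_one_of_one_le₀ (one_le_pow₀ (by linarith [abs_nonneg q.1])))
  · exact integrable_inv_one_add_norm_pow_four.const_mul C
  · refine Filter.Eventually.of_forall fun ζ => ?_
    exact (by fun_prop : Continuous fun q : ℝ × ℂ =>
      Complex.exp (Complex.I * (inner ℝ ζ q.2 : ℝ))).mul
      (hc.comp (by fun_prop : Continuous fun q : ℝ × ℂ => (q.1, ζ)))

theorem norm_partialFourier_le_axis {φ : E3 → ℂ} (hφ : IsDecaying φ) :
    ∃ C : ℝ, 0 ≤ C ∧ ∀ t ω, ‖partialFourier φ t ω‖ ≤ C * ((1 + |t|) ^ 4)⁻¹ := by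
  obtain ⟨hc, C, hC, hb⟩ := hφ.axis
  refine ⟨‖((2 * π : ℂ) ^ 2)⁻¹‖ * (C * ∫ ζ : ℂ, ((1 + ‖ζ‖) ^ 4)⁻¹), by positivity, fun t ω => ?_⟩
  rw [partialFourier, norm_mul, mul_assoc]
  gcongr
  rw [mul_right_comm, ← integral_const_mul]
  refine norm_integral_le_of_norm_le (integrable_inv_one_add_norm_pow_four.const_mul _)
    (Filter.Eventually.of_forall fun ζ => ?_)
  rw [norm_mul, norm_cexp_I_mul, one_mul, mul_assoc]
  exact hb t ζ

theorem integrable_partialFourier {φ : E3 → ℂ} (hφ : IsDecaying φ) (ω : ℂ) :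
    Integrable fun t => partialFourier φ t ω := by
  obtain ⟨C, hC, hb⟩ := norm_partialFourier_le_axis hφ
  refine (integrable_inv_one_add_abs_pow_four.const_mul C).mono' ?_
    (Filter.Eventually.of_forall fun t => hb t ω)
  exact ((continuous_partialFourier hφ).comp
    (by fun_prop : Continuous fun t : ℝ => (t, ω))).aestronglyMeasurable

theorem IsDecaying.integrable_axis {φ : E3 → ℂ} (hφ : IsDecaying φ) :
    Integrable fun q => φ (axisEquiv q) := by
  obtain ⟨hc, C, hC, hb⟩ := hφ.axis
  exact ((integrable_inv_one_add_abs_pow_four.mul_prod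
    integrable_inv_one_add_norm_pow_four).const_mul C).mono' hc.aestronglyMeasurable
    (Filter.Eventually.of_forall fun q => hb q.1 q.2)

theorem IsDecaying.integrable_slice_left {φ : E3 → ℂ} (hφ : IsDecaying φ) (ω : ℂ) :
    Integrable fun s => φ (axisEquiv (s, ω)) := by
  obtain ⟨hc, C, hC, hb⟩ := hφ.axis
  exact ((integrable_inv_one_add_abs_pow_four.mul_const _).const_mul C).mono'
    (hc.comp (by fun_prop : Continuous fun s : ℝ => (s, ω))).aestronglyMeasurable
    (Filter.Eventually.of_forall fun s => hb s ω)

theorem IsDecaying.integrable_slice_right {φ : E3 → ℂ} (hφ : IsDecaying φ) (t : ℝ) :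
    Integrable fun ζ => φ (axisEquiv (t, ζ)) := by
  obtain ⟨hc, C, hC, hb⟩ := hφ.axis
  exact ((integrable_inv_one_add_norm_pow_four.const_mul _).const_mul C).mono'
    (hc.comp (by fun_prop : Continuous fun ζ : ℂ => (t, ζ))).aestronglyMeasurable
    (Filter.Eventually.of_forall fun ζ => hb t ζ)

theorem IsFourierPair.axis_eq {φ ψ : E3 → ℂ} (h : IsFourierPair φ ψ) (s : ℝ) (ω : ℂ) :
    ψ (axisEquiv (s, ω)) =
      (2 * π : ℂ)⁻¹ * ∫ t : ℝ, Complex.exp (Complex.I * (t * s : ℝ)) * partialFourier φ t ω := by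
  have hi : Integrable fun q : ℝ × ℂ =>
      Complex.exp (Complex.I * (q.1 * s + inner ℝ q.2 ω : ℝ)) * φ (axisEquiv q) :=
    h.left.integrable_axis.bdd_mul (c := 1) (Continuous.aestronglyMeasurable (by fun_prop))
      (Filter.Eventually.of_forall fun q => (norm_cexp_I_mul _).le)
  rw [h.eq, ← measurePreserving_axisEquiv.integral_comp axisEquiv.measurableEmbedding]
  simp only [inner_axisEquiv]
  rw [Measure.volume_eq_prod, integral_prod _ hi]
  have : (((2 * π : ℝ) ^ 3)⁻¹ : ℂ) = (2 * π : ℂ)⁻¹ * ((2 * π : ℂ) ^ 2)⁻¹ := by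
    rw [← mul_inv]; push_cast; ring
  rw [this, mul_assoc, ← integral_const_mul]
  congr 1
  refine integral_congr_ae (Filter.Eventually.of_forall fun t => ?_)
  simp only
  rw [partialFourier, mul_left_comm]
  congr 1
  rw [← integral_const_mul]
  refine integral_congr_ae (Filter.Eventually.of_forall fun ζ => ?_)
  simp only
  rw [← mul_assoc, ← Complex.exp_add]
  push_cast
  ring_nf

theorem IsFourierPair.partialFourier_eq {φ ψ : E3 → ℂ} (h : IsFourierPair φ ψ) (t : ℝ) (ω : ℂ) :
    partialFourier φ t ω =
      ∫ s : ℝ, Complex.exp (-(Complex.I * (t * s : ℝ))) * ψ (axisEquiv (s, ω)) := by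
  have hc : Continuous fun t => partialFourier φ t ω :=
    Continuous.comp (g := fun q : ℝ × ℂ => partialFourier φ q.1 q.2) (f := fun t : ℝ => (t, ω))
      (continuous_partialFourier h.left) (by fun_prop)
  exact fourier_inversion_line hc (integrable_partialFourier h.left ω)
    (h.right.integrable_slice_left ω) (fun s => h.axis_eq s ω) t

/-- The geometric mean of the decay along the axis, read off from `φ`, and of the decay across the
axis, read off from `ψ`. -/
theorem IsFourierPair.norm_partialFourier_le {φ ψ : E3 → ℂ} (h : IsFourierPair φ ψ) :
    ∃ C : ℝ, 0 ≤ C ∧ ∀ t ω, ‖partialFourier φ t ω‖ ≤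
      C * (((1 + |t|) ^ 2)⁻¹ * ((1 + ‖ω‖) ^ 2)⁻¹) := by
  obtain ⟨C₁, hC₁, hb₁⟩ := norm_partialFourier_le_axis h.left
  obtain ⟨-, C, hC, hb⟩ := h.right.axis
  have hb₂ : ∀ t ω, ‖partialFourier φ t ω‖ ≤
      (C * ∫ s : ℝ, ((1 + |s|) ^ 4)⁻¹) * ((1 + ‖ω‖) ^ 4)⁻¹ := by
    intro t ω
    rw [h.partialFourier_eq, mul_right_comm, ← integral_const_mul]
    refine norm_integral_le_of_norm_le (integrable_inv_one_add_abs_pow_four.const_mul _)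
      (Filter.Eventually.of_forall fun s => ?_)
    rw [norm_mul, norm_cexp_neg_I_mul, one_mul, mul_assoc, mul_comm ((1 + ‖ω‖) ^ 4)⁻¹]
    exact hb s ω
  set C₂ := C * ∫ s : ℝ, ((1 + |s|) ^ 4)⁻¹
  have hC₂ : 0 ≤ C₂ := by positivity
  refine ⟨√(C₁ * C₂), by positivity, fun t ω => abs_le_of_sq_le_sq ?_ (by positivity) |>.trans'
    (le_abs_self _)⟩
  have hsq : √(C₁ * C₂) ^ 2 = C₁ * C₂ := Real.sq_sqrt (by positivity)
  calc ‖partialFourier φ t ω‖ ^ 2 = ‖partialFourier φ t ω‖ * ‖partialFourier φ t ω‖ := sq _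
    _ ≤ (C₁ * ((1 + |t|) ^ 4)⁻¹) * (C₂ * ((1 + ‖ω‖) ^ 4)⁻¹) :=
        mul_le_mul (hb₁ t ω) (hb₂ t ω) (norm_nonneg _) (by positivity)
    _ = _ := by
        rw [mul_pow, hsq, mul_pow, inv_pow, inv_pow, ← pow_mul, ← pow_mul]
        ring

/-- Parseval's identity on the lines parallel to the axis. -/
theorem IsFourierPair.integral_line {φ ψ : E3 → ℂ} (h : IsFourierPair φ ψ) {τ : ℝ} (hτ : 0 ≤ τ)
    {ω : ℂ} (h0 : 0 < ‖ω‖) (hne : ‖ω‖ ≠ τ) :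
    ∫ s : ℝ, (conjSymbol τ (axisEquiv (s, ω)))⁻¹ * ψ (axisEquiv (s, ω)) =
      ∫ t : ℝ, axisKernel τ ‖ω‖ t * partialFourier φ t ω := by
  have hi : Integrable (Function.uncurry fun s t : ℝ => Complex.exp (-(Complex.I * (t * s : ℝ))) *
      axisKernel τ ‖ω‖ t * ψ (axisEquiv (s, ω))) := by
    have h1 := (h.right.integrable_slice_left ω).mul_prod
      ((integrable_axisKernel hτ h0 hne).ofReal (𝕜 := ℂ))
    refine (h1.bdd_mul (c := 1) (f := fun p : ℝ × ℝ =>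
      Complex.exp (-(Complex.I * (p.2 * p.1 : ℝ)))) ?_ ?_).congr ?_
    · exact Continuous.aestronglyMeasurable (by fun_prop)
    · exact Filter.Eventually.of_forall fun p => (norm_cexp_neg_I_mul _).le
    · refine Filter.Eventually.of_forall fun p => ?_
      simp only [Function.uncurry]
      rw [mul_assoc, mul_comm (ψ _)]
      rfl
  calc ∫ s : ℝ, (conjSymbol τ (axisEquiv (s, ω)))⁻¹ * ψ (axisEquiv (s, ω))
      = ∫ s : ℝ, ∫ t : ℝ, Complex.exp (-(Complex.I * (t * s : ℝ))) *
          axisKernel τ ‖ω‖ t * ψ (axisEquiv (s, ω)) := by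
        congr 1 with s
        rw [conjSymbol_axisEquiv, ← (axisKernel_transform hτ h0 hne s).2, integral_mul_const]
    _ = ∫ t : ℝ, ∫ s : ℝ, Complex.exp (-(Complex.I * (t * s : ℝ))) *
          axisKernel τ ‖ω‖ t * ψ (axisEquiv (s, ω)) := integral_integral_swap hi
    _ = _ := by
        congr 1 with t
        rw [h.partialFourier_eq, ← integral_const_mul]
        congr 1 with s
        ring

/-- Parseval's identity on the planes orthogonal to the axis that miss the origin. -/
theorem integral_plane {φ : E3 → ℂ} (hφ : IsDecaying φ) {τ t : ℝ} (hτ : 0 ≤ τ) (ht : t ≠ 0) :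
    ∫ ω : ℂ, axisKernel τ ‖ω‖ t * partialFourier φ t ω =
      ∫ ζ : ℂ, conjKernel τ t ‖ζ‖ * φ (axisEquiv (t, ζ)) := by
  have hi : Integrable (Function.uncurry fun ω ζ : ℂ => ((2 * π : ℂ) ^ 2)⁻¹ *
      (axisKernel τ ‖ω‖ t * Complex.exp (Complex.I * (inner ℝ ζ ω : ℝ))) *
        φ (axisEquiv (t, ζ))) := by
    have h1 := ((integrable_axisKernel_norm τ ht).ofReal (𝕜 := ℂ)).mul_prod
      (hφ.integrable_slice_right t)
    refine ((h1.bdd_mul (c := 1) (f := fun p : ℂ × ℂ =>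
      Complex.exp (Complex.I * (inner ℝ p.2 p.1 : ℝ))) ?_ ?_).const_mul
        ((2 * π : ℂ) ^ 2)⁻¹).congr ?_
    · exact Continuous.aestronglyMeasurable (by fun_prop)
    · exact Filter.Eventually.of_forall fun p => (norm_cexp_I_mul _).le
    · refine Filter.Eventually.of_forall fun p => ?_
      simp only [Function.uncurry, RCLike.ofReal_eq_complex_ofReal]
      ring
  calc ∫ ω : ℂ, axisKernel τ ‖ω‖ t * partialFourier φ t ω
      = ∫ ω : ℂ, ∫ ζ : ℂ, ((2 * π : ℂ) ^ 2)⁻¹ *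
          (axisKernel τ ‖ω‖ t * Complex.exp (Complex.I * (inner ℝ ζ ω : ℝ))) *
            φ (axisEquiv (t, ζ)) := by
        congr 1 with ω
        rw [partialFourier, mul_left_comm, ← integral_const_mul, ← integral_const_mul]
        congr 1 with ζ
        ring
    _ = ∫ ζ : ℂ, ∫ ω : ℂ, ((2 * π : ℂ) ^ 2)⁻¹ *
          (axisKernel τ ‖ω‖ t * Complex.exp (Complex.I * (inner ℝ ζ ω : ℝ))) *
            φ (axisEquiv (t, ζ)) := integral_integral_swap hi
    _ = _ := by
        congr 1 with ζ
        rw [integral_mul_const, integral_const_mul, integral_axisKernel_mul_cexp hτ ht,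
          inv_mul_cancel_left₀ (pow_ne_zero 2 (by exact_mod_cast Real.two_pi_pos.ne'))]

theorem IsFourierPair.integrable_axisKernel_mul {φ ψ : E3 → ℂ} (h : IsFourierPair φ ψ) {τ : ℝ}
    (hτ : 0 ≤ τ) : Integrable (Function.uncurry fun (ω : ℂ) (t : ℝ) =>
      axisKernel τ ‖ω‖ t * partialFourier φ t ω) := by
  obtain ⟨C, hC, hb⟩ := h.norm_partialFourier_le
  have h1 : Integrable fun t : ℝ => ((1 + |t|) ^ 2)⁻¹ := by
    simpa using integrable_inv_one_add_norm_pow (volume : Measure ℝ) (k := 2) (by simp)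
  refine ((integrable_inv_norm_mul_inv_pow.mul_prod h1).const_mul (C / 2)).mono' ?_ ?_
  · refine AEStronglyMeasurable.mul ?_ ?_
    · exact (Complex.measurable_ofReal.comp ((measurable_axisKernel τ).comp
        (by fun_prop : Measurable fun p : ℂ × ℝ => (‖p.1‖, p.2)))).aestronglyMeasurable
    · exact ((continuous_partialFourier h.left).comp continuous_swap).aestronglyMeasurable
  · have hae : ∀ᵐ q : ℂ × ℝ, 0 < ‖q.1‖ :=
      Measure.quasiMeasurePreserving_fst.ae ((ae_norm_pos_and_ne 0).mono fun _ h => h.1)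
    filter_upwards [hae] with q hq
    rw [Function.uncurry, norm_mul, Complex.norm_real, Real.norm_eq_abs]
    calc |axisKernel τ ‖q.1‖ q.2| * ‖partialFourier φ q.2 q.1‖
        ≤ 1 / (2 * ‖q.1‖) * (C * (((1 + |q.2|) ^ 2)⁻¹ * ((1 + ‖q.1‖) ^ 2)⁻¹)) :=
          mul_le_mul (abs_axisKernel_le hτ hq _) (hb _ _) (norm_nonneg _) (by positivity)
      _ = _ := by field_simp

/-- Parseval's identity for the reciprocal symbol: the double integral over `(t, ω)` converges
absolutely, which reduces the claim to lines parallel to the axis and to planes orthogonal to it. -/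
theorem IsFourierPair.integral_inv_conjSymbol_mul {φ ψ : E3 → ℂ} (h : IsFourierPair φ ψ) {τ : ℝ}
    (hτ : 0 ≤ τ) :
    ∫ ξ, (conjSymbol τ ξ)⁻¹ * ψ ξ = ∫ x, conjSolution τ x * φ x := by
  have hi := integrable_mul_of_weight (integrable_inv_conjSymbol_mul hτ) h.right
  have hj : Integrable fun x => conjSolution τ x * φ x :=
    integrable_mul_of_norm_le (continuousOn_conjSolution τ) (A := 3 * √2 / (4 * π))
      (fun x hx => by rw [div_div]; exact norm_conjSolution_le hτ hx) h.left
  rw [← measurePreserving_axisEquiv.integral_comp axisEquiv.measurableEmbedding,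
    ← measurePreserving_axisEquiv.integral_comp axisEquiv.measurableEmbedding]
  rw [← measurePreserving_axisEquiv.integrable_comp_emb axisEquiv.measurableEmbedding] at hi hj
  rw [Measure.volume_eq_prod] at hi hj ⊢
  calc _ = ∫ ω : ℂ, ∫ s : ℝ, (conjSymbol τ (axisEquiv (s, ω)))⁻¹ * ψ (axisEquiv (s, ω)) :=
        integral_prod_symm _ hi
    _ = ∫ ω : ℂ, ∫ t : ℝ, axisKernel τ ‖ω‖ t * partialFourier φ t ω := by
        refine integral_congr_ae ?_
        filter_upwards [ae_norm_pos_and_ne τ] with ω hω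
        exact h.integral_line hτ hω.1 hω.2
    _ = ∫ t : ℝ, ∫ ω : ℂ, axisKernel τ ‖ω‖ t * partialFourier φ t ω :=
        integral_integral_swap (h.integrable_axisKernel_mul hτ)
    _ = ∫ t : ℝ, ∫ ζ : ℂ, conjKernel τ t ‖ζ‖ * φ (axisEquiv (t, ζ)) := by
        refine integral_congr_ae ?_
        filter_upwards [Measure.ae_ne volume (0 : ℝ)] with t ht
        exact integral_plane h.left hτ ht
    _ = _ := by
        refine Eq.trans ?_ (integral_prod _ hj).symm
        simp [conjSolution]

/-! ### Tempered distributions given by functions -/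

theorem norm_schwartz_le (φ : 𝓢(E3, ℂ)) (x : E3) :
    ‖φ x‖ ≤ 2 ^ 8 * (Finset.Iic (8, 0)).sup (schwartzSeminormFamily ℂ E3 ℂ) φ *
      ((1 + ‖x‖) ^ 8)⁻¹ := by
  have h := SchwartzMap.one_add_le_sup_seminorm_apply (𝕜 := ℂ) (m := (8, 0)) (k := 8) (n := 0)
    le_rfl le_rfl φ x
  rw [norm_iteratedFDeriv_zero] at h
  rw [← div_eq_mul_inv, le_div_iff₀ (by positivity), mul_comm]
  exact h

theorem isDecaying_schwartz (φ : 𝓢(E3, ℂ)) : IsDecaying φ :=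
  ⟨φ.continuous, _, by positivity, norm_schwartz_le φ⟩

theorem isFourierPair_schwartz (φ : 𝓢(E3, ℂ)) : IsFourierPair φ (invFourier φ) :=
  ⟨isDecaying_schwartz φ, isDecaying_schwartz _, invFourier_apply φ⟩

theorem exists_isGivenBy {f : E3 → ℂ}
    (hf : Integrable fun ξ => f ξ * (((1 + ‖ξ‖) ^ 8)⁻¹ : ℝ)) :
    ∃ M : 𝓢'(E3, ℂ), IsGivenBy M f := by
  have hi : ∀ φ : 𝓢(E3, ℂ), Integrable fun ξ => f ξ * φ ξ := fun φ =>
    integrable_mul_of_weight hf (isDecaying_schwartz φ)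
  let L : 𝓢(E3, ℂ) →L[ℂ] ℂ := SchwartzMap.mkCLMtoNormedSpace (σ := RingHom.id ℂ)
    (fun φ => ∫ ξ, f ξ * φ ξ)
    (fun φ χ => by
      simp only [add_apply, mul_add]
      exact integral_add (hi φ) (hi χ))
    (fun c φ => by
      simp only [smul_apply, smul_eq_mul, mul_left_comm (f _), RingHom.id_apply]
      exact integral_const_mul _ _)
    ⟨Finset.Iic (8, 0), 2 ^ 8 * ∫ ξ : E3, ‖f ξ * (((1 + ‖ξ‖) ^ 8)⁻¹ : ℝ)‖, by positivity,
      fun φ => by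
        rw [mul_right_comm, ← integral_const_mul]
        refine norm_integral_le_of_norm_le (hf.norm.const_mul _)
          (Filter.Eventually.of_forall fun ξ => ?_)
        rw [norm_mul, norm_mul, Complex.norm_real, Real.norm_of_nonneg (by positivity)]
        refine (mul_le_mul_of_nonneg_left (norm_schwartz_le φ ξ) (norm_nonneg (f ξ))).trans_eq ?_
        ring⟩
  exact ⟨ContinuousLinearMap.toPointwiseConvergenceCLM _ _ _ _ L, fun φ => ⟨hi φ, rfl⟩⟩

/-! ### The conjugated Laplacian -/

theorem integral_invFourier (φ : 𝓢(E3, ℂ)) : ∫ ξ, invFourier φ ξ = φ 0 := by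
  have h : ∀ ξ, invFourier φ ξ = (((2 * π : ℝ) ^ 3)⁻¹ : ℂ) * (𝓕⁻ φ) ((2 * π)⁻¹ • ξ) :=
    fun ξ => rfl
  have h0 : φ 0 = ∫ x, (𝓕⁻ φ) x := by
    conv_lhs => rw [← FourierTransform.fourier_fourierInv_eq (F := 𝓢(E3, ℂ)) φ, SchwartzMap.fourier_coe]
    rw [Real.fourier_eq']
    simp
  simp only [h]
  rw [integral_const_mul, Measure.integral_comp_inv_smul, h0, Complex.real_smul,
    abs_of_pos (by positivity)]
  simp only [finrank_euclideanSpace, Fintype.card_fin]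
  push_cast
  have : (π : ℂ) ≠ 0 := by exact_mod_cast Real.pi_ne_zero
  field_simp

theorem invFourier_lineDeriv (φ : 𝓢(E3, ℂ)) (m ξ : E3) :
    invFourier (∂_{m} φ) ξ = -(Complex.I * (inner ℝ ξ m : ℝ)) * invFourier φ ξ := by
  have h : ∀ χ : 𝓢(E3, ℂ), invFourier χ ξ =
      (((2 * π : ℝ) ^ 3)⁻¹ : ℂ) * (𝓕⁻ χ) ((2 * π)⁻¹ • ξ) := fun χ => rfl
  have hg : (inner ℝ · m : E3 → ℝ).HasTemperateGrowth := by fun_prop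
  rw [h, h, SchwartzMap.fourierInv_lineDerivOp_eq, smul_apply,
    SchwartzMap.smulLeftCLM_apply_apply hg, inner_smul_left, smul_eq_mul, Complex.real_smul]
  have : (π : ℂ) ≠ 0 := by exact_mod_cast Real.pi_ne_zero
  simp only [conj_trivial]
  push_cast
  field_simp

theorem invFourier_laplacian (φ : 𝓢(E3, ℂ)) (ξ : E3) :
    invFourier (Δ φ) ξ = -(‖ξ‖ ^ 2 : ℝ) * invFourier φ ξ := by
  rw [SchwartzMap.laplacian_eq_sum (EuclideanSpace.basisFun (Fin 3) ℝ), map_sum, sum_apply,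
    EuclideanSpace.norm_sq_eq]
  simp only [invFourier_lineDeriv, EuclideanSpace.basisFun_apply, Fin.sum_univ_three,
    EuclideanSpace.inner_single_right, Real.norm_eq_abs, sq_abs]
  simp
  linear_combination (((ξ 0 : ℂ)) ^ 2 + (ξ 1 : ℂ) ^ 2 + (ξ 2 : ℂ) ^ 2) * invFourier φ ξ *
    Complex.I_sq

theorem conjSymbol_ne_zero_ae (τ : ℝ) : ∀ᵐ ξ : E3, conjSymbol τ ξ ≠ 0 := by
  rcases eq_or_ne τ 0 with rfl | hτ
  · filter_upwards [Measure.ae_ne volume (0 : E3)] with ξ hξ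
    simp [conjSymbol, hξ]
  · have h : ∀ᵐ q : ℝ × ℂ, q.1 ≠ 0 :=
      Measure.quasiMeasurePreserving_fst.ae (Measure.ae_ne volume (0 : ℝ))
    have h2 := measurePreserving_axisEquiv.symm.quasiMeasurePreserving.ae h
    filter_upwards [h2] with ξ hξ h0
    have h3 := congrArg Complex.im h0
    have h4 : ((τ : ℂ) ^ 2).im = 0 := by rw [← Complex.ofReal_pow, Complex.ofReal_im]
    have h5 : ξ 0 ≠ 0 := hξ
    have h6 : (((‖ξ‖ : ℂ)) ^ 2).im = 0 := by rw [← Complex.ofReal_pow, Complex.ofReal_im]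
    simp [conjSymbol, h4, h6, hτ, h5] at h3

/-- The inverse Fourier transform turns the adjoint of the conjugated Laplacian into multiplication
by the symbol. -/
theorem conjLaplacian_eq_delta {τ : ℝ} {E : 𝓢'(E3, ℂ)}
    (hE : IsInvFourierOfReciprocal (conjSymbol τ) E) :
    conjLaplacian τ E = TemperedDistribution.delta 0 := by
  obtain ⟨M, hM, rfl⟩ := hE
  ext φ
  set χ : 𝓢(E3, ℂ) := -Δ φ - (2 * τ : ℂ) • ∂_{(EuclideanSpace.single 0 1 : E3)} φ -
    ((τ : ℂ) ^ 2) • φ with hχ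
  have h1 : conjLaplacian τ (invFourierDistr M) φ = invFourierDistr M χ := by
    simp only [conjLaplacian, hχ, map_sub, map_neg, map_smul]
    change -((Δ (invFourierDistr M)) φ) +
      (2 * τ : ℂ) • (∂_{(EuclideanSpace.single 0 1 : E3)} (invFourierDistr M)) φ -
      ((τ : ℂ) ^ 2) • invFourierDistr M φ = _
    rw [TemperedDistribution.laplacian_apply_apply, TemperedDistribution.lineDerivOp_apply_apply,
      map_neg]
    simp only [smul_eq_mul]
    ring
  have h2 : ∀ ξ, invFourier χ ξ = conjSymbol τ ξ * invFourier φ ξ := by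
    intro ξ
    simp only [hχ, map_sub, map_neg, map_smul, sub_apply, neg_apply,
      smul_apply, invFourier_laplacian, invFourier_lineDeriv, conjSymbol,
      EuclideanSpace.inner_single_right, smul_eq_mul]
    simp
    ring
  rw [h1, TemperedDistribution.delta_apply, ← integral_invFourier φ]
  change M (invFourier χ) = _
  rw [(hM _).2]
  refine integral_congr_ae ?_
  filter_upwards [conjSymbol_ne_zero_ae τ] with ξ hξ
  rw [h2, inv_mul_cancel_left₀ hξ]

/-! ### Rotated and translated symbols -/

theorem IsDecaying.comp_sub {φ : E3 → ℂ} (hφ : IsDecaying φ) (R : E3 ≃ₗᵢ[ℝ] E3) (a : E3) :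
    IsDecaying fun x => φ (R x - a) := by
  obtain ⟨hc, C, hC, hb⟩ := hφ
  refine ⟨hc.comp (by fun_prop), C * (1 + ‖a‖) ^ 8, by positivity, fun x => (hb _).trans ?_⟩
  rw [mul_assoc]
  gcongr
  have h : 1 + ‖x‖ ≤ (1 + ‖a‖) * (1 + ‖R x - a‖) := by
    have h1 : ‖x‖ ≤ ‖R x - a‖ + ‖a‖ := by
      rw [← R.norm_map x]
      simpa using norm_add_le (R x - a) a
    nlinarith [norm_nonneg a, norm_nonneg (R x - a), mul_nonneg (norm_nonneg a)
      (norm_nonneg (R x - a))]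
  rw [← div_eq_mul_inv, inv_le_comm₀ (by positivity) (by positivity), inv_div,
    div_le_iff₀ (by positivity), mul_comm, ← mul_pow]
  gcongr

theorem IsFourierPair.comp {φ ψ : E3 → ℂ} (h : IsFourierPair φ ψ) (R : E3 ≃ₗᵢ[ℝ] E3) (a : E3) :
    IsFourierPair (fun y => Complex.exp (-(Complex.I * (inner ℝ (R.symm y) a : ℝ))) * φ (R.symm y))
      (fun η => ψ (R.symm η - a)) where
  left := by
    have h1 := h.left.comp_sub R.symm 0
    simp only [sub_zero] at h1
    obtain ⟨hc, C, hC, hb⟩ := h1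
    refine ⟨?_, C, hC, fun x => ?_⟩
    · exact Continuous.mul (by fun_prop) hc
    · rw [norm_mul, norm_cexp_neg_I_mul, one_mul]
      exact hb x
  right := h.right.comp_sub R.symm a
  eq η := by
    rw [h.eq, ← R.symm.measurePreserving.integral_comp
      R.symm.toMeasurableEquiv.measurableEmbedding]
    congr 1
    refine integral_congr_ae (Filter.Eventually.of_forall fun y => ?_)
    simp only
    rw [inner_sub_right, LinearIsometryEquiv.inner_map_map, ← mul_assoc, ← Complex.exp_add]
    congr 2
    push_cast
    ring

theorem measurePreserving_rotate_add (R : E3 ≃ₗᵢ[ℝ] E3) (a : E3) :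
    MeasurePreserving ((MeasurableEquiv.addRight a).trans R.toMeasurableEquiv) :=
  (measurePreserving_add_right volume a).trans R.measurePreserving

theorem integrable_inv_symbol_mul {τ : ℝ} (hτ : 0 ≤ τ) (R : E3 ≃ₗᵢ[ℝ] E3) (a : E3) :
    Integrable fun ξ => (conjSymbol τ (R (ξ + a)))⁻¹ * (((1 + ‖ξ‖) ^ 8)⁻¹ : ℝ) := by
  have hw : IsDecaying fun ξ : E3 => ((((1 + ‖ξ‖) ^ 8)⁻¹ : ℝ) : ℂ) := by
    refine ⟨?_, 1, zero_le_one, fun x => ?_⟩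
    · refine Complex.continuous_ofReal.comp (Continuous.inv₀ (by fun_prop) fun x => by positivity)
    · rw [Complex.norm_real, Real.norm_of_nonneg (by positivity), one_mul]
  have h := integrable_mul_of_weight (integrable_inv_conjSymbol_mul hτ) (hw.comp_sub R.symm a)
  rw [← (measurePreserving_rotate_add R a).integrable_comp_emb
    (MeasurableEquiv.measurableEmbedding _)] at h
  refine h.congr (Filter.Eventually.of_forall fun ξ => ?_)
  change (conjSymbol τ (R (ξ + a)))⁻¹ * (((1 + ‖R.symm (R (ξ + a)) - a‖) ^ 8)⁻¹ : ℝ) = _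
  rw [R.symm_apply_apply, add_sub_cancel_right]

/-- A rotation and a translation of the frequencies rotate the kernel and multiply it by a
character of modulus one, so the bound persists. -/
theorem exists_invFourier_reciprocal {τ : ℝ} (hτ : 0 ≤ τ) (R : E3 ≃ₗᵢ[ℝ] E3) (a : E3)
    {p : E3 → ℂ} (hp : ∀ ξ, p ξ = conjSymbol τ (R (ξ + a))) :
    ∃ E : 𝓢'(E3, ℂ), ∃ e : E3 → ℂ, IsInvFourierOfReciprocal p E ∧ IsGivenBy E e ∧
      ContinuousOn e {0}ᶜ ∧ ∀ x : E3, x ≠ 0 → ‖e x‖ ≤ 3 * √2 / (4 * π * ‖x‖) := by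
  obtain ⟨M, hM⟩ := exists_isGivenBy (integrable_inv_symbol_mul hτ R a)
  set e : E3 → ℂ := fun x =>
    Complex.exp (-(Complex.I * (inner ℝ x a : ℝ))) * conjSolution τ (R x) with he
  have hcont : ContinuousOn e {0}ᶜ := by
    refine ContinuousOn.mul (by fun_prop) ((continuousOn_conjSolution τ).comp (by fun_prop) ?_)
    intro x hx
    have hx : x ≠ 0 := hx
    simpa using hx
  have hbound : ∀ x : E3, x ≠ 0 → ‖e x‖ ≤ 3 * √2 / (4 * π * ‖x‖) := by
    intro x hx
    have h := norm_conjSolution_le hτ (x := R x) (by simpa using hx)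
    rw [R.norm_map] at h
    rwa [he, norm_mul, norm_cexp_neg_I_mul, one_mul]
  have hpM : IsGivenBy M fun ξ => (p ξ)⁻¹ := by
    simp only [hp]
    exact hM
  refine ⟨invFourierDistr M, e, ⟨M, hpM, rfl⟩, fun φ => ⟨?_, ?_⟩, hcont, hbound⟩
  · exact integrable_mul_of_norm_le hcont (A := 3 * √2 / (4 * π))
      (fun x hx => by rw [div_div]; exact hbound x hx) (isDecaying_schwartz φ)
  · change M (invFourier φ) = _
    have hpair := (isFourierPair_schwartz φ).comp R a
    have h1 := hpair.integral_inv_conjSymbol_mul hτ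
    rw [← (measurePreserving_rotate_add R a).integral_comp
      (MeasurableEquiv.measurableEmbedding _)] at h1
    rw [(hM _).2]
    refine Eq.trans ?_ (h1.trans ((R.measurePreserving.integral_comp
      R.toMeasurableEquiv.measurableEmbedding _).symm.trans ?_))
    · refine integral_congr_ae (Filter.Eventually.of_forall fun ξ => ?_)
      change _ = (conjSymbol τ (R (ξ + a)))⁻¹ * invFourier φ (R.symm (R (ξ + a)) - a)
      rw [R.symm_apply_apply, add_sub_cancel_right]
    · refine integral_congr_ae (Filter.Eventually.of_forall fun x => ?_)
      simp only [he, R.symm_apply_apply]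
      ring

/-- A reflection takes `b` to the distinguished axis. -/
theorem exists_isometry_conjSymbol (b : E3) : ∃ R : E3 ≃ₗᵢ[ℝ] E3, ∀ η,
    conjSymbol ‖b‖ (R η) =
      (‖η‖ ^ 2 : ℝ) + 2 * Complex.I * (inner ℝ η b : ℝ) - ((‖b‖ ^ 2 : ℝ) : ℂ) := by
  set w : E3 := EuclideanSpace.single 0 ‖b‖ with hw
  have hbw : ‖b‖ = ‖w‖ := by simp [hw]
  set R : E3 ≃ₗᵢ[ℝ] E3 := Submodule.reflection (ℝ ∙ (b - w))ᗮ with hR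
  have hRb : R b = w := Submodule.reflection_sub hbw
  refine ⟨R, fun η => ?_⟩
  have h : inner ℝ η b = ‖b‖ * R η 0 := by
    rw [← R.inner_map_map, hRb, hw, EuclideanSpace.inner_single_right]
    simp
  rw [conjSymbol, R.norm_map, h]
  push_cast
  ring

theorem exists_isometry_conjSymbol_abs (τ : ℝ) : ∃ R : E3 ≃ₗᵢ[ℝ] E3, ∀ ξ,
    conjSymbol τ ξ = conjSymbol |τ| (R (ξ + 0)) := by
  obtain ⟨R, hR⟩ := exists_isometry_conjSymbol (EuclideanSpace.single 0 τ)
  refine ⟨R, fun ξ => ?_⟩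
  simp only [PiLp.norm_single, Real.norm_eq_abs, EuclideanSpace.inner_single_right,
    sq_abs] at hR
  rw [add_zero, hR, conjSymbol]
  simp
  ring

theorem exists_isometry_cgoSymbol (z : Fin 3 → ℂ) (hz : z ⬝ᵥ z = 0) :
    ∃ τ : ℝ, 0 ≤ τ ∧ ∃ (R : E3 ≃ₗᵢ[ℝ] E3) (a : E3), ∀ ξ,
      cgoSymbol z ξ = conjSymbol τ (R (ξ + a)) := by
  set a : E3 := !₂[(z 0).re, (z 1).re, (z 2).re] with ha
  set b : E3 := !₂[(z 0).im, (z 1).im, (z 2).im] with hb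
  obtain ⟨R, hR⟩ := exists_isometry_conjSymbol b
  refine ⟨‖b‖, norm_nonneg _, R, a, fun ξ => ?_⟩
  rw [hR, cgoSymbol]
  have hre := congrArg Complex.re hz
  have him := congrArg Complex.im hz
  simp only [dotProduct, Fin.sum_univ_three, Complex.add_re, Complex.add_im, Complex.mul_re,
    Complex.mul_im, Complex.zero_re, Complex.zero_im] at hre him
  simp only [EuclideanSpace.norm_sq_eq, Fin.sum_univ_three, Real.norm_eq_abs, sq_abs,
    PiLp.inner_apply, RCLike.inner_apply, conj_trivial, PiLp.add_apply, ha, hb]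
  apply Complex.ext
  · simp [sq]
    linear_combination -hre
  · simp [sq]
    linear_combination -him / 2

theorem lemmaB2 :
    (∀ τ : ℝ, ∃ E : 𝓢'(E3, ℂ), ∃ e : E3 → ℂ,
      IsInvFourierOfReciprocal (conjSymbol τ) E ∧
      conjLaplacian τ E = TemperedDistribution.delta 0 ∧
      IsGivenBy E e ∧ ContinuousOn e {0}ᶜ ∧
      ∀ x : E3, x ≠ 0 → ‖e x‖ ≤ 3 * √2 / (4 * π * ‖x‖)) ∧
    (∃ A : ℝ, 0 < A ∧ A ≤ 3 * √2 / (4 * π) ∧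
      ∀ z : Fin 3 → ℂ, z ⬝ᵥ z = 0 →
        ∃ E : 𝓢'(E3, ℂ), ∃ e : E3 → ℂ,
          IsInvFourierOfReciprocal (cgoSymbol z) E ∧
          IsGivenBy E e ∧ ContinuousOn e {0}ᶜ ∧
          ∀ x : E3, x ≠ 0 → ‖e x‖ ≤ A / ‖x‖) := by
  refine ⟨fun τ => ?_, 3 * √2 / (4 * π), by positivity, le_rfl, fun z hz => ?_⟩
  · obtain ⟨R, hR⟩ := exists_isometry_conjSymbol_abs τ
    obtain ⟨E, e, hE, hg, hc, hb⟩ := exists_invFourier_reciprocal (abs_nonneg τ) R 0 hR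
    exact ⟨E, e, hE, conjLaplacian_eq_delta hE, hg, hc, hb⟩
  · obtain ⟨τ, hτ, R, a, hR⟩ := exists_isometry_cgoSymbol z hz
    obtain ⟨E, e, hE, hg, hc, hb⟩ := exists_invFourier_reciprocal hτ R a hR
    exact ⟨E, e, hE, hg, hc, fun x hx => by rw [div_div]; exact hb x hx⟩
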